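/- Let $0<L<\infty$, $\lambda_1,\lambda_2>0$, and let $\mu_1,\mu_2\ge 0$ be functions on $(0,L)$ with $\int_0^l\mu_i(x)\,dx<\infty$ for all $0<l<L$ and $\int_0^L\mu_i(x)\,dx=\infty$, $i=1,2$. Let $X=\mathbb{C}\times L^1(0,L)\times L^1(0,L)$ (complex-valued functions) with the norm $\|(p_0,p_1,p_2)\|=|p_0|+\|p_1\|_{L^1}+\|p_2\|_{L^1}$, and let $\mathcal A:D(\mathcal A)\subset X\to X$ be $$\mathcal A(p_0,p_1,p_2)=\Big(-(\lambda_1+\lambda_2)p_0+\sum_{i=1}^2\int_0^L\mu_ip_i\,dx,\ -\big(p_1'+\mu_1p_1+\lambda_2p_1\big),\ -\big(p_2'+\mu_2p_2\big)\Big)$$ with domain $$D(\mathcal A)=\Big\{(p_0,p_1,p_2)\in X:\ p_i\in W^{1,1}(0,L),\ \mu_ip_i\in L^1(0,L)\ (i=1,2),\ p_1(0)=\lambda_1p_0,\ p_2(0)=\lambda_2p_0+\lambda_2\int_0^Lp_1\,dx\Big\}.$$ Then: 1. the resolvent set $\rho(\mathcal A)$ contains $\{r\in\mathbb{C}:\mathrm{Re}\,r>0\}\cup\{ia:a\in\mathbb{R},\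 a\ne0\}$; 2. for every $r\in\rho(\mathcal A)$ the resolvent operator $(rI-\mathcal A)^{-1}$ is compact on $X$; 3. $0$ is a simple eigenvalue of $\mathcal A$ (the space $\bigcup_k\ker\mathcal A^k$ of generalized eigenvectors is one-dimensional), and $0$ is the only real eigenvalue of $\mathcal A$. -/

import Mathlib

open MeasureTheory Set
open scoped ContDiff

noncomputable section

namespace Repairable

/-! ### Spectral notions for an unbounded operator `A : D(A) ⊆ X → X` -/

section Unbounded

variable {X : Type*} [NormedAddCommGroup X] [NormedSpace ℂ X]

/-- The bounded everywhere defined operator `R` is the inverse of `r I - A : D(A) → X`. -/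
def IsResolventAt (A : X →ₗ.[ℂ] X) (r : ℂ) (R : X →L[ℂ] X) : Prop :=
  (∀ y : X, ∃ x : A.domain, (x : X) = R y ∧ r • (x : X) - A x = y) ∧
    ∀ x : A.domain, R (r • (x : X) - A x) = x

/-- The resolvent set `ρ(A)`. -/
def resolventSet (A : X →ₗ.[ℂ] X) : Set ℂ :=
  {r | ∃ R : X →L[ℂ] X, IsResolventAt A r R}

/-- `r` is an eigenvalue of `A`. -/
def IsEigenvalue (A : X →ₗ.[ℂ] X) (r : ℂ) : Prop :=
  ∃ x : A.domain, (x : X) ≠ 0 ∧ A x = r • (x : X)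

/-- `ker (A - r I) ^ k`, where `x ∈ ker (A - r I) ^ (k + 1)` means that `x ∈ D(A)` and
`(A - r I) x ∈ ker (A - r I) ^ k`. -/
def genEigenspace (A : X →ₗ.[ℂ] X) (r : ℂ) : ℕ → Submodule ℂ X
  | 0 => ⊥
  | k + 1 => ((genEigenspace A r k).comap
      (A.toFun - r • A.domain.subtype)).map A.domain.subtype

/-- `r` is an eigenvalue of `A` of algebraic multiplicity one: the space of all generalized
eigenvectors is one-dimensional. -/
def IsSimpleEigenvalue (A : X →ₗ.[ℂ] X) (r : ℂ) : Prop :=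
  IsEigenvalue A r ∧
    Module.finrank ℂ (⨆ k, genEigenspace A r k : Submodule ℂ X) = 1

end Unbounded

/-! ### Function spaces on `(0, L)` -/

/-- Complex `L¹(0, L)`. -/
abbrev L1 (L : ℝ) : Type := Lp ℂ 1 (volume.restrict (Ioo 0 L))

/-- The (complexified) state space `ℂ × L¹(0, L) × L¹(0, L)` with the norm
`|p₀| + ‖p₁‖ + ‖p₂‖`. -/
abbrev State (L : ℝ) : Type := WithLp 1 (ℂ × WithLp 1 (L1 L × L1 L))

variable {L : ℝ}

/-- The state `(a, u, v)`. -/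
def State.mk (a : ℂ) (u v : L1 L) : State L := WithLp.toLp 1 (a, WithLp.toLp 1 (u, v))

/-- The component `p₀`. -/
abbrev State.p0 (p : State L) : ℂ := p.fst

/-- The component `p₁`. -/
abbrev State.p1 (p : State L) : L1 L := p.snd.fst

/-- The component `p₂`. -/
abbrev State.p2 (p : State L) : L1 L := p.snd.snd

/-- `v` is a weak derivative of `u` on `(0, L)`. -/
def IsWeakDeriv (u v : L1 L) : Prop :=
  ∀ φ : ℝ → ℝ, ContDiff ℝ ∞ φ → HasCompactSupport φ → tsupport φ ⊆ Ioo 0 L →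
    ∫ x in Ioo 0 L, deriv φ x • u x = -∫ x in Ioo 0 L, φ x • v x

theorem integrable_test_smul {φ : ℝ → ℝ} (hφ : Continuous φ) (hc : HasCompactSupport φ)
    (u : L1 L) : Integrable (fun x => φ x • u x) (volume.restrict (Ioo 0 L)) := by
  obtain ⟨C, hC⟩ := hφ.bounded_above_of_compact_support hc
  exact (L1.integrable_coeFn u).bdd_smul C hφ.aestronglyMeasurable (Filter.Eventually.of_forall hC)

theorem integral_test_add {φ : ℝ → ℝ} (hφ : Continuous φ) (hc : HasCompactSupport φ)
    (u v : L1 L) : ∫ x in Ioo 0 L, φ x • (u + v : L1 L) x =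
      (∫ x in Ioo 0 L, φ x • u x) + ∫ x in Ioo 0 L, φ x • v x := by
  rw [← integral_add (integrable_test_smul hφ hc u) (integrable_test_smul hφ hc v)]
  refine integral_congr_ae ?_
  filter_upwards [Lp.coeFn_add u v] with x hx
  rw [hx, Pi.add_apply, smul_add]

theorem integral_test_smul (φ : ℝ → ℝ) (c : ℂ) (u : L1 L) :
    ∫ x in Ioo 0 L, φ x • (c • u : L1 L) x = c • ∫ x in Ioo 0 L, φ x • u x := by
  rw [← integral_smul]
  refine integral_congr_ae ?_
  filter_upwards [Lp.coeFn_smul c u] with x hx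
  rw [hx, Pi.smul_apply, smul_comm]

theorem continuous_deriv_test {φ : ℝ → ℝ} (hφ : ContDiff ℝ ∞ φ) : Continuous (deriv φ) :=
  hφ.continuous_deriv (by simp)

theorem IsWeakDeriv.add {u v u' v' : L1 L} (h : IsWeakDeriv u u') (k : IsWeakDeriv v v') :
    IsWeakDeriv (u + v) (u' + v') := by
  intro φ hφ hc hs
  rw [integral_test_add (continuous_deriv_test hφ) hc.deriv,
    integral_test_add hφ.continuous hc, h φ hφ hc hs, k φ hφ hc hs, neg_add]

theorem IsWeakDeriv.smul {u u' : L1 L} (c : ℂ) (h : IsWeakDeriv u u') :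
    IsWeakDeriv (c • u) (c • u') := by
  intro φ hφ hc hs
  rw [integral_test_smul, integral_test_smul, h φ hφ hc hs, smul_neg]

theorem isWeakDeriv_zero : IsWeakDeriv (0 : L1 L) 0 := by
  intro φ hφ hc hs
  have e : ∀ ψ : ℝ → ℝ, ∫ x in Ioo 0 L, ψ x • (0 : L1 L) x = 0 := by
    intro ψ
    have := integral_test_smul (L := L) ψ 0 0
    simpa using this
  rw [e, e, neg_zero]

theorem IsWeakDeriv.unique {u v w : L1 L} (hv : IsWeakDeriv u v) (hw : IsWeakDeriv u w) :
    v = w := by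
  have hi : IntegrableOn (fun x => v x - w x) (Ioo 0 L) :=
    (L1.integrable_coeFn v).sub (L1.integrable_coeFn w)
  have key : ∀ᵐ x : ℝ, x ∈ Ioo 0 L → v x - w x = 0 := by
    refine isOpen_Ioo.ae_eq_zero_of_integral_contDiff_smul_eq_zero hi.locallyIntegrableOn ?_
    intro φ hφ hc hs
    have e : ∫ x, φ x • (v x - w x) = ∫ x in Ioo 0 L, φ x • (v x - w x) := by
      refine (setIntegral_eq_integral_of_forall_compl_eq_zero fun x hx => ?_).symm
      rw [image_eq_zero_of_notMem_tsupport fun h => hx (hs h), zero_smul]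
    rw [e]
    simp only [smul_sub]
    rw [integral_sub (integrable_test_smul hφ.continuous hc v)
      (integrable_test_smul hφ.continuous hc w), sub_eq_zero]
    have := (hv φ hφ hc hs).symm.trans (hw φ hφ hc hs)
    exact neg_injective this
  refine Lp.ext ?_
  have := (ae_restrict_iff' (μ := volume) measurableSet_Ioo).2 key
  filter_upwards [this] with x hx
  exact sub_eq_zero.1 hx

variable (L) in
/-- The Sobolev space `W^{1,1}(0, L)` as a subspace of `L¹(0, L)`. -/
def W11 : Submodule ℂ (L1 L) where
  carrier := {u | ∃ v, IsWeakDeriv u v}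
  add_mem' := by
    rintro u v ⟨u', hu⟩ ⟨v', hv⟩
    exact ⟨_, hu.add hv⟩
  zero_mem' := ⟨0, isWeakDeriv_zero⟩
  smul_mem' := by
    rintro c u ⟨u', hu⟩
    exact ⟨_, hu.smul c⟩

variable (L) in
/-- The weak derivative `d/dx : W^{1,1}(0, L) → L¹(0, L)`. -/
def weakDeriv : W11 L →ₗ[ℂ] L1 L where
  toFun u := u.2.choose
  map_add' u v := (u + v).2.choose_spec.unique (u.2.choose_spec.add v.2.choose_spec)
  map_smul' c u := (c • u).2.choose_spec.unique (u.2.choose_spec.smul c)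

theorem weakDeriv_spec (u : W11 L) : IsWeakDeriv (u : L1 L) (weakDeriv L u) :=
  u.2.choose_spec

/-- `u(0) = c`: the continuous representative of `u` on `[0, L]` exists and takes the value `c`
at `0`. -/
def HasValueAtZero (u : L1 L) (c : ℂ) : Prop :=
  ∃ f : ℝ → ℂ, ContinuousOn f (Icc 0 L) ∧ u =ᵐ[volume.restrict (Ioo 0 L)] f ∧ f 0 = c

theorem HasValueAtZero.add {u v : L1 L} {a b : ℂ} (hu : HasValueAtZero u a)
    (hv : HasValueAtZero v b) : HasValueAtZero (u + v) (a + b) := by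
  obtain ⟨f, hf, hfe, rfl⟩ := hu
  obtain ⟨g, hg, hge, rfl⟩ := hv
  exact ⟨f + g, hf.add hg, (Lp.coeFn_add u v).trans (hfe.add hge), rfl⟩

theorem HasValueAtZero.smul {u : L1 L} {a : ℂ} (c : ℂ) (hu : HasValueAtZero u a) :
    HasValueAtZero (c • u) (c * a) := by
  obtain ⟨f, hf, hfe, rfl⟩ := hu
  exact ⟨c • f, hf.const_smul c, (Lp.coeFn_smul c u).trans (hfe.const_smul c), rfl⟩

theorem hasValueAtZero_zero : HasValueAtZero (0 : L1 L) 0 :=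
  ⟨0, continuousOn_const, Lp.coeFn_zero _ _ _, rfl⟩

theorem coeFn_mul_add (μ : ℝ → ℝ) (u v : L1 L) :
    (fun x => (μ x : ℂ) * (u + v : L1 L) x) =ᵐ[volume.restrict (Ioo 0 L)]
      (fun x => (μ x : ℂ) * u x) + fun x => (μ x : ℂ) * v x := by
  filter_upwards [Lp.coeFn_add u v] with x hx
  rw [Pi.add_apply, hx, Pi.add_apply, mul_add]

theorem coeFn_mul_smul (μ : ℝ → ℝ) (c : ℂ) (u : L1 L) :
    (fun x => (μ x : ℂ) * (c • u : L1 L) x) =ᵐ[volume.restrict (Ioo 0 L)]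
      c • fun x => (μ x : ℂ) * u x := by
  filter_upwards [Lp.coeFn_smul c u] with x hx
  simp only [hx, Pi.smul_apply, smul_eq_mul]
  ring

variable (L) in
/-- The functions `u ∈ L¹(0, L)` with `μ u ∈ L¹(0, L)`. -/
def mulDomain (μ : ℝ → ℝ) : Submodule ℂ (L1 L) where
  carrier := {u | Integrable (fun x => (μ x : ℂ) * u x) (volume.restrict (Ioo 0 L))}
  add_mem' := by
    intro u v hu hv
    exact (Integrable.add hu hv).congr (coeFn_mul_add μ u v).symm
  zero_mem' := by
    refine (integrable_zero ℝ ℂ _).congr ?_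
    filter_upwards [Lp.coeFn_zero ℂ 1 (volume.restrict (Ioo 0 L))] with x hx
    rw [hx, Pi.zero_apply, mul_zero]
  smul_mem' := by
    intro c u hu
    exact (Integrable.smul c hu).congr (coeFn_mul_smul μ c u).symm

theorem mulDomain_integrable {μ : ℝ → ℝ} (u : mulDomain L μ) :
    Integrable (fun x => (μ x : ℂ) * (u : L1 L) x) (volume.restrict (Ioo 0 L)) := u.2

variable (L) in
/-- Multiplication `u ↦ μ u` with values in `L¹(0, L)`. -/
def mulOp (μ : ℝ → ℝ) : mulDomain L μ →ₗ[ℂ] L1 L where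
  toFun u := (mulDomain_integrable u).toL1 (fun x => (μ x : ℂ) * (u : L1 L) x)
  map_add' u v := by
    refine Lp.ext ?_
    filter_upwards [(mulDomain_integrable (u + v)).coeFn_toL1, (mulDomain_integrable u).coeFn_toL1,
      (mulDomain_integrable v).coeFn_toL1, coeFn_mul_add μ (u : L1 L) v,
      Lp.coeFn_add ((mulDomain_integrable u).toL1 _) ((mulDomain_integrable v).toL1 _)]
      with x h1 h2 h3 h4 h5
    rw [h1, h5, Pi.add_apply, h2, h3]
    exact h4
  map_smul' c u := by
    refine Lp.ext ?_
    filter_upwards [(mulDomain_integrable (c • u)).coeFn_toL1, (mulDomain_integrable u).coeFn_toL1,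
      coeFn_mul_smul μ c (u : L1 L), Lp.coeFn_smul c ((mulDomain_integrable u).toL1 _)]
      with x h1 h2 h3 h4
    rw [h1, RingHom.id_apply, h4, Pi.smul_apply, h2]
    exact h3

variable (L) in
/-- `u ↦ ∫₀ᴸ u(x) dx`. -/
def integralOp : L1 L →ₗ[ℂ] ℂ where
  toFun u := ∫ x in Ioo 0 L, u x
  map_add' u v := by
    rw [← integral_add (L1.integrable_coeFn u) (L1.integrable_coeFn v)]
    exact integral_congr_ae (Lp.coeFn_add u v)
  map_smul' c u := by
    rw [RingHom.id_apply, ← integral_smul]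
    exact integral_congr_ae (Lp.coeFn_smul c u)

/-! ### The system operator -/

variable (L) in
/-- A repair rate on `[0, L)`: nonnegative, integrable on `(0, l)` for every `l < L`, with
`∫₀ᴸ μ = ∞`. -/
structure IsRepairRate (μ : ℝ → ℝ) : Prop where
  nonneg : ∀ x ∈ Ioo 0 L, 0 ≤ μ x
  integrableOn : ∀ l, 0 < l → l < L → IntegrableOn μ (Ioo 0 l)
  lintegral_eq_top : ∫⁻ x in Ioo 0 L, ENNReal.ofReal (μ x) = ⊤

variable (L) in
/-- The domain of the system operator: `p₁, p₂ ∈ W^{1,1}(0, L)`, `μᵢ pᵢ ∈ L¹(0, L)`,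
`p₁(0) = λ₁ p₀` and `p₂(0) = λ₂ p₀ + λ₂ ∫₀ᴸ p₁`. -/
def systemDomain (lam₁ lam₂ : ℝ) (μ₁ μ₂ : ℝ → ℝ) : Submodule ℂ (State L) where
  carrier := {p | p.p1 ∈ W11 L ∧ p.p2 ∈ W11 L ∧ p.p1 ∈ mulDomain L μ₁ ∧ p.p2 ∈ mulDomain L μ₂ ∧
    HasValueAtZero p.p1 (lam₁ * p.p0) ∧
    HasValueAtZero p.p2 (lam₂ * p.p0 + lam₂ * integralOp L p.p1)}
  add_mem' := by
    rintro p q ⟨h1, h2, h3, h4, h5, h6⟩ ⟨k1, k2, k3, k4, k5, k6⟩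
    refine ⟨add_mem h1 k1, add_mem h2 k2, add_mem h3 k3, add_mem h4 k4, ?_, ?_⟩
    · have e : (lam₁ : ℂ) * (p + q).p0 = lam₁ * p.p0 + lam₁ * q.p0 := mul_add _ p.p0 q.p0
      rw [e]
      exact h5.add k5
    · have e0 : (p + q).p0 = p.p0 + q.p0 := rfl
      have e1 : (p + q).p1 = p.p1 + q.p1 := rfl
      have e : (lam₂ : ℂ) * (p + q).p0 + lam₂ * integralOp L (p + q).p1 =
          (lam₂ * p.p0 + lam₂ * integralOp L p.p1) + (lam₂ * q.p0 + lam₂ * integralOp L q.p1) := by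
        rw [e0, e1, map_add]
        ring
      rw [e]
      exact h6.add k6
  zero_mem' := by
    refine ⟨zero_mem _, zero_mem _, zero_mem _, zero_mem _, ?_, ?_⟩
    · have e : (lam₁ : ℂ) * (0 : State L).p0 = 0 := mul_zero _
      rw [e]
      exact hasValueAtZero_zero
    · have e0 : (0 : State L).p0 = 0 := rfl
      have e1 : (0 : State L).p1 = 0 := rfl
      have e : (lam₂ : ℂ) * (0 : State L).p0 + lam₂ * integralOp L (0 : State L).p1 = 0 := by
        rw [e0, e1, map_zero, mul_zero, add_zero]
      rw [e]
      exact hasValueAtZero_zero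
  smul_mem' := by
    rintro c p ⟨h1, h2, h3, h4, h5, h6⟩
    refine ⟨Submodule.smul_mem _ c h1, Submodule.smul_mem _ c h2, Submodule.smul_mem _ c h3,
      Submodule.smul_mem _ c h4, ?_, ?_⟩
    · have e : (lam₁ : ℂ) * (c • p).p0 = c * (lam₁ * p.p0) := mul_left_comm _ c p.p0
      rw [e]
      exact h5.smul c
    · have e0 : (c • p).p0 = c * p.p0 := rfl
      have e1 : (c • p).p1 = c • p.p1 := rfl
      have e : (lam₂ : ℂ) * (c • p).p0 + lam₂ * integralOp L (c • p).p1 =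
          c * (lam₂ * p.p0 + lam₂ * integralOp L p.p1) := by
        rw [e0, e1, map_smul, smul_eq_mul]
        ring
      rw [e]
      exact h6.smul c

section Components

variable {lam₁ lam₂ : ℝ} {μ₁ μ₂ : ℝ → ℝ}

/-- `p₁` as an element of `W^{1,1}(0, L)`. -/
def sob1 (p : systemDomain L lam₁ lam₂ μ₁ μ₂) : W11 L := ⟨p.1.p1, p.2.1⟩

/-- `p₂` as an element of `W^{1,1}(0, L)`. -/
def sob2 (p : systemDomain L lam₁ lam₂ μ₁ μ₂) : W11 L := ⟨p.1.p2, p.2.2.1⟩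

/-- `p₁` as an element of the domain of multiplication by `μ₁`. -/
def wt1 (p : systemDomain L lam₁ lam₂ μ₁ μ₂) : mulDomain L μ₁ := ⟨p.1.p1, p.2.2.2.1⟩

/-- `p₂` as an element of the domain of multiplication by `μ₂`. -/
def wt2 (p : systemDomain L lam₁ lam₂ μ₁ μ₂) : mulDomain L μ₂ := ⟨p.1.p2, p.2.2.2.2.1⟩

end Components

variable (L) in
/-- The system operator
`A (p₀, p₁, p₂) = (-(λ₁ + λ₂) p₀ + ∫ μ₁ p₁ + ∫ μ₂ p₂, -(p₁' + μ₁ p₁ + λ₂ p₁), -(p₂' + μ₂ p₂))`. -/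
def systemOp (lam₁ lam₂ : ℝ) (μ₁ μ₂ : ℝ → ℝ) : State L →ₗ.[ℂ] State L where
  domain := systemDomain L lam₁ lam₂ μ₁ μ₂
  toFun :=
    { toFun := fun p => State.mk
        (-(lam₁ + lam₂) * p.1.p0 + integralOp L (mulOp L μ₁ (wt1 p))
          + integralOp L (mulOp L μ₂ (wt2 p)))
        (-(weakDeriv L (sob1 p) + mulOp L μ₁ (wt1 p) + (lam₂ : ℂ) • p.1.p1))
        (-(weakDeriv L (sob2 p) + mulOp L μ₂ (wt2 p)))
      map_add' := by
        intro p q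
        have s1 : sob1 (p + q) = sob1 p + sob1 q := rfl
        have s2 : sob2 (p + q) = sob2 p + sob2 q := rfl
        have w1 : wt1 (p + q) = wt1 p + wt1 q := rfl
        have w2 : wt2 (p + q) = wt2 p + wt2 q := rfl
        have e0 : (p + q).1.p0 = p.1.p0 + q.1.p0 := rfl
        have e1 : (p + q).1.p1 = p.1.p1 + q.1.p1 := rfl
        rw [s1, s2, w1, w2, e0, e1]
        simp only [map_add, State.mk, ← WithLp.toLp_add, Prod.mk_add_mk, smul_add]
        congr 2
        · ring
        · congr 2
          · abel
          · abel
      map_smul' := by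
        intro c p
        have s1 : sob1 (c • p) = c • sob1 p := rfl
        have s2 : sob2 (c • p) = c • sob2 p := rfl
        have w1 : wt1 (c • p) = c • wt1 p := rfl
        have w2 : wt2 (c • p) = c • wt2 p := rfl
        have e0 : (c • p).1.p0 = c • p.1.p0 := rfl
        have e1 : (c • p).1.p1 = c • p.1.p1 := rfl
        rw [s1, s2, w1, w2, e0, e1]
        simp only [map_smul, State.mk, ← WithLp.toLp_smul, Prod.smul_mk, smul_add, smul_neg,
          RingHom.id_apply, smul_eq_mul, smul_comm (lam₂ : ℂ) c]
        congr 2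
        ring }

end Repairable

end

noncomputable section

namespace Repairable

open Filter Topology

section

/-! ### Absolutely continuous functions -/

/-! The equation `r p - A p = y` splits into scalar problems u' + μ u + c u = f, u(0) = a, with c =
r + λ₂ for p₁ and c = r for p₂, coupled only through the number p₀. On `[0, l]` with l < L, each is
solved uniquely by an integrating factor. Up to L, nonnegativity of μ bounds the solution kernel,
and comparison with the nonnegative problem for |a|, |f|, Re c bounds ∫ μ|u| (`exists_isSol`).

Since ∫ μ = ∞ while μ u is integrable, the continuous representative of u vanishes at L
(`primitive_eq_zero_of_mem_mulDomain`). Integrating the equation gives the mass balance ∫ μ u = a -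
c ∫ u + ∫ f. Inserted into the equation for p₀, the two balances turn it into r · total(p) =
total(y), where total(p) = p₀ + ∫ p₁ + ∫ p₂. By linearity total(p) = D(r) p₀ + (terms in y), with
D(r) = `charFun`, so r is in the resolvent set as soon as r D(r) ≠ 0.

For real r the fundamental solutions are nonnegative, so D(r) ≥ 1. For Re r ≥ 0, r ≠ 0, the mass
balance turns D(r) = 0 into |r + λ₁ + λ₂| ≤ λ₁ + λ₂, a disc that meets the closed right half-plane
only at 0 (`charFun_ne_zero_of_re_nonneg`).

The scalar solution operators factor through the Volterra operator, a norm limit of finite rank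
operators, and the resolvent differs from them by finite rank terms; hence it is compact. At r = 0
the kernel is spanned by one state of total mass D(0) ≠ 0, while every element of the range of A has
total mass 0, so there are no Jordan chains. -/

/-- Serves to pass from real to complex values and through the exponential. -/
theorem absolutelyContinuousOnInterval_of_dist_le {X Y : Type*} [PseudoMetricSpace X]
    [PseudoMetricSpace Y] {f : ℝ → X} {g : ℝ → Y} {K a b : ℝ}
    (hf : AbsolutelyContinuousOnInterval f a b)
    (h : ∀ x ∈ uIcc a b, ∀ y ∈ uIcc a b, dist (g x) (g y) ≤ K * dist (f x) (f y)) :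
    AbsolutelyContinuousOnInterval g a b := by
  unfold AbsolutelyContinuousOnInterval at hf ⊢
  refine squeeze_zero' ?_ ?_ (by simpa using hf.const_mul K)
  · exact Eventually.of_forall fun _ => Finset.sum_nonneg fun i _ => dist_nonneg
  rw [eventually_inf_principal]
  filter_upwards with E hE
  rw [Finset.mul_sum]
  exact Finset.sum_le_sum fun i hi => h _ (hE.1 i hi).1 _ (hE.1 i hi).2

theorem absolutelyContinuousOnInterval_ofReal {f : ℝ → ℝ} {a b : ℝ}
    (hf : AbsolutelyContinuousOnInterval f a b) :
    AbsolutelyContinuousOnInterval (fun x => (f x : ℂ)) a b :=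
  absolutelyContinuousOnInterval_of_dist_le (K := 1) hf fun x _ y _ => by
    rw [Complex.isometry_ofReal.dist_eq, one_mul]

theorem absolutelyContinuousOnInterval_primitive {f : ℝ → ℂ} {a b : ℝ}
    (h : IntervalIntegrable f volume a b) :
    AbsolutelyContinuousOnInterval (fun x => ∫ t in a..x, f t) a b := by
  have hre : IntervalIntegrable (fun t => (f t).re) volume a b := ⟨h.1.re, h.2.re⟩
  have him : IntervalIntegrable (fun t => (f t).im) volume a b := ⟨h.1.im, h.2.im⟩
  have h1 := absolutelyContinuousOnInterval_ofReal
    (hre.absolutelyContinuousOnInterval_intervalIntegral left_mem_uIcc)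
  have h2 := absolutelyContinuousOnInterval_ofReal
    (him.absolutelyContinuousOnInterval_intervalIntegral left_mem_uIcc)
  have e : ∀ x ∈ uIcc a b, ∫ t in a..x, f t =
      ((∫ t in a..x, (f t).re : ℝ) : ℂ) + Complex.I • ((∫ t in a..x, (f t).im : ℝ) : ℂ) := by
    intro x hx
    have hs : uIcc a x ⊆ uIcc a b := uIcc_subset_uIcc_left hx
    rw [← intervalIntegral.integral_ofReal, ← intervalIntegral.integral_ofReal,
      ← intervalIntegral.integral_smul, ← intervalIntegral.integral_add]
    · refine intervalIntegral.integral_congr fun t _ => ?_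
      simp only [smul_eq_mul]
      rw [mul_comm, Complex.re_add_im]
    · exact ⟨(hre.mono_set hs).1.ofReal, (hre.mono_set hs).2.ofReal⟩
    · have him' : IntervalIntegrable (fun t => ((f t).im : ℂ)) volume a x :=
        ⟨(him.mono_set hs).1.ofReal, (him.mono_set hs).2.ofReal⟩
      exact him'.smul Complex.I
  refine absolutelyContinuousOnInterval_of_dist_le (K := 1) (h1.add (h2.const_smul Complex.I))
    fun x hx y hy => ?_
  rw [one_mul, e x hx, e y hy]
  rfl

/-- The difference between f and the primitive of g is absolutely continuous with derivative zero
almost everywhere, hence constant. -/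
theorem eq_add_integral_of_ac {f g : ℝ → ℂ} {a b : ℝ} (hab : a ≤ b)
    (hf : AbsolutelyContinuousOnInterval f a b) (hg : IntervalIntegrable g volume a b)
    (hd : ∀ᵐ x, x ∈ uIcc a b → HasDerivAt f (g x) x) {x : ℝ} (hx : x ∈ Icc a b) :
    f x = f a + ∫ t in a..x, g t := by
  have h1 := hf.sub (absolutelyContinuousOnInterval_primitive hg)
  obtain ⟨C, hC⟩ := h1.const_of_ae_hasDerivAt_zero (by
    filter_upwards [hd, hg.ae_hasDerivAt_integral] with x h1 h2 hx
    simpa using (h1 hx).sub (h2 hx a left_mem_uIcc))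
  rw [uIcc_of_le hab] at hC
  have e1 := hC x hx
  have e2 := hC a (left_mem_Icc.2 hab)
  simp only [Pi.sub_apply, intervalIntegral.integral_same, sub_zero] at e1 e2
  rw [e2, ← e1]
  ring

/-- Product rule for primitives. -/
theorem mul_eq_add_integral {u v u' v' : ℝ → ℂ} {a b : ℝ} (hab : a ≤ b)
    (hu : AbsolutelyContinuousOnInterval u a b) (hv : AbsolutelyContinuousOnInterval v a b)
    (hu' : IntervalIntegrable u' volume a b) (hv' : IntervalIntegrable v' volume a b)
    (hdu : ∀ᵐ x, x ∈ uIcc a b → HasDerivAt u (u' x) x)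
    (hdv : ∀ᵐ x, x ∈ uIcc a b → HasDerivAt v (v' x) x) {x : ℝ} (hx : x ∈ Icc a b) :
    u x * v x = u a * v a + ∫ t in a..x, (u' t * v t + u t * v' t) := by
  refine eq_add_integral_of_ac (f := fun x => u x * v x) hab (hu.smul hv)
    ((hu'.mul_continuousOn hv.continuousOn).add (hv'.continuousOn_mul hu.continuousOn)) ?_ hx
  filter_upwards [hdu, hdv] with x h1 h2 hx
  exact (h1 hx).mul (h2 hx)

/-! ### Weak derivatives and primitives -/

variable {L : ℝ}

theorem intervalIntegrable_L1 (hL : 0 < L) (v : L1 L) : IntervalIntegrable v volume 0 L :=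
  (intervalIntegrable_iff_integrableOn_Ioo_of_le hL.le).2 (L1.integrable_coeFn v)

theorem integral_Ioo_eq_intervalIntegral {E : Type*} [NormedAddCommGroup E] [NormedSpace ℝ E]
    (hL : 0 < L) (f : ℝ → E) : ∫ x in Ioo 0 L, f x = ∫ x in 0..L, f x := by
  rw [intervalIntegral.integral_of_le hL.le, integral_Ioc_eq_integral_Ioo]

theorem continuousOn_primitive_L1 (hL : 0 < L) (v : L1 L) :
    ContinuousOn (fun x => ∫ t in 0..x, v t) (Icc 0 L) := by
  have := (absolutelyContinuousOnInterval_primitive (intervalIntegrable_L1 hL v)).continuousOn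
  rwa [uIcc_of_le hL.le] at this

/-- Integration by parts; the boundary terms drop out because the test function vanishes at 0 and L.
-/
theorem isWeakDeriv_of_ae_eq_primitive (hL : 0 < L) {u v : L1 L} {a : ℂ}
    (h : u =ᵐ[volume.restrict (Ioo 0 L)] fun x => a + ∫ t in 0..x, v t) : IsWeakDeriv u v := by
  intro φ hφ hc hs
  have hv := intervalIntegrable_L1 hL v
  have h0 : φ 0 = 0 := image_eq_zero_of_notMem_tsupport fun k => (hs k).1.false
  have h1 : φ L = 0 := image_eq_zero_of_notMem_tsupport fun k => (hs k).2.false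
  have hd : ∀ x, HasDerivAt φ (deriv φ x) x := fun x =>
    (hφ.differentiable (by simp) x).hasDerivAt
  have hcd := continuous_deriv_test hφ
  have key := mul_eq_add_integral (u := fun x => (φ x : ℂ)) (v := fun x => a + ∫ t in 0..x, v t)
    (u' := fun x => ((deriv φ x : ℝ) : ℂ)) (v' := v) hL.le
    (absolutelyContinuousOnInterval_ofReal
      (hφ.of_le (by simp)).contDiffOn.absolutelyContinuousOnInterval)
    ((contDiff_const (n := 1)).contDiffOn.absolutelyContinuousOnInterval.add
      (absolutelyContinuousOnInterval_primitive hv))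
    ((Complex.continuous_ofReal.comp hcd).intervalIntegrable _ _) hv
    (Eventually.of_forall fun x _ => (hd x).ofReal_comp)
    (by
      filter_upwards [hv.ae_hasDerivAt_integral] with x hx hx'
      exact (hx hx' 0 left_mem_uIcc).const_add a) (right_mem_Icc.2 hL.le)
  simp only [h0, h1, Complex.ofReal_zero, zero_mul, zero_add] at key
  have e1 : ∫ x in Ioo 0 L, deriv φ x • u x =
      ∫ x in 0..L, ((deriv φ x : ℝ) : ℂ) * (a + ∫ t in 0..x, v t) := by
    rw [← integral_Ioo_eq_intervalIntegral hL]
    refine integral_congr_ae ?_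
    filter_upwards [h] with x hx
    rw [hx, Complex.real_smul]
  have e2 : ∫ x in Ioo 0 L, φ x • v x = ∫ x in 0..L, (φ x : ℂ) * v x := by
    rw [← integral_Ioo_eq_intervalIntegral hL]
    simp only [Complex.real_smul]
  rw [e1, e2]
  rw [intervalIntegral.integral_add] at key
  · exact eq_neg_of_add_eq_zero_left key.symm
  · refine ContinuousOn.intervalIntegrable ?_
    rw [uIcc_of_le hL.le]
    exact (Complex.continuous_ofReal.comp hcd).continuousOn.mul
      (continuousOn_const.add (continuousOn_primitive_L1 hL v))
  · exact hv.continuousOn_mul (Complex.continuous_ofReal.comp hφ.continuous).continuousOn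

/-- A test function of mean zero is the derivative of a test function. -/
theorem exists_primitive_test {ψ : ℝ → ℝ} (hψ : ContDiff ℝ ∞ ψ)
    (hc : HasCompactSupport ψ) (hs : tsupport ψ ⊆ Ioo 0 L) (h0 : ∫ x, ψ x = 0) :
    ∃ φ : ℝ → ℝ, ContDiff ℝ ∞ φ ∧ HasCompactSupport φ ∧ tsupport φ ⊆ Ioo 0 L ∧ deriv φ = ψ := by
  rcases (tsupport ψ).eq_empty_or_nonempty with he | hne
  · have : ψ = 0 := tsupport_eq_empty_iff.1 he
    exact ⟨0, contDiff_const, HasCompactSupport.zero, by simp [tsupport], by simp [this]⟩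
  obtain ⟨α, hα⟩ := hc.isCompact.exists_isLeast hne
  obtain ⟨β, hβ⟩ := hc.isCompact.exists_isGreatest hne
  have hd : ∀ x, HasDerivAt (fun x => ∫ t in 0..x, ψ t) (ψ x) x := fun x =>
    intervalIntegral.integral_hasDerivAt_right (hψ.continuous.intervalIntegrable _ _)
      (hψ.continuous.stronglyMeasurableAtFilter _ _) hψ.continuous.continuousAt
  have hde : deriv (fun x => ∫ t in 0..x, ψ t) = ψ := funext fun x => (hd x).deriv
  -- Left of α the integrand is zero; right of β the integral already equals the full mean, which is
  -- zero.
  have hsub : Function.support (fun x => ∫ t in 0..x, ψ t) ⊆ Icc α β := by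
    intro x hx
    by_contra hn
    apply hx
    rw [mem_Icc, not_and_or, not_le, not_le] at hn
    have hz : ∀ t, t < α ∨ β < t → ψ t = 0 := by
      intro t ht
      refine image_eq_zero_of_notMem_tsupport fun k => ?_
      rcases ht with ht | ht
      · exact (hα.2 k).not_gt ht
      · exact (hβ.2 k).not_gt ht
    rcases hn with hn | hn
    · have : ∫ t in 0..x, ψ t = ∫ t in 0..x, (0 : ℝ) := by
        refine intervalIntegral.integral_congr fun t ht => hz t (Or.inl ?_)
        exact ht.2.trans_lt (max_lt (hs hα.1).1 hn)
      simpa using this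
    · change ∫ t in 0..x, ψ t = 0
      rw [intervalIntegral.integral_eq_integral_of_support_subset, h0]
      intro t ht
      have := subset_tsupport _ ht
      exact ⟨(hs this).1, (hβ.2 this).trans hn.le⟩
  have hts : tsupport (fun x => ∫ t in 0..x, ψ t) ⊆ Icc α β :=
    closure_minimal hsub isClosed_Icc
  refine ⟨_, ?_, isCompact_Icc.of_isClosed_subset (isClosed_tsupport _) hts,
    hts.trans fun x hx => ⟨(hs hα.1).1.trans_le hx.1, hx.2.trans_lt (hs hβ.1).2⟩, hde⟩
  rw [contDiff_infty_iff_deriv, hde]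
  exact ⟨fun x => (hd x).differentiableAt, hψ⟩

/-- The lemma of du Bois-Reymond. -/
theorem ae_eq_const_of_isWeakDeriv_zero (hL : 0 < L) {w : L1 L} (hw : IsWeakDeriv w 0) :
    ∃ k : ℂ, w =ᵐ[volume.restrict (Ioo 0 L)] fun _ => k := by
  let b : ContDiffBump (L / 2) := ⟨L / 8, L / 4, by positivity, by linarith⟩
  have hη : ContDiff ℝ ∞ (b.normed volume) := b.contDiff_normed
  have hηc : HasCompactSupport (b.normed volume) := b.hasCompactSupport_normed
  have hηs : tsupport (b.normed volume) ⊆ Ioo 0 L := by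
    rw [b.tsupport_normed_eq, Real.closedBall_eq_Icc]
    intro x hx
    have h1 : b.rOut = L / 4 := rfl
    rw [h1] at hx
    constructor <;> linarith [hx.1, hx.2]
  have hη1 : ∫ x, b.normed volume x = 1 := b.integral_normed
  set η := b.normed volume with hη_def
  refine ⟨∫ x in Ioo 0 L, η x • w x, ?_⟩
  set k := ∫ x in Ioo 0 L, η x • w x
  have hi : IntegrableOn (fun x => w x - k) (Ioo 0 L) :=
    (L1.integrable_coeFn w).sub (integrable_const k)
  have key : ∀ᵐ x : ℝ, x ∈ Ioo 0 L → w x - k = 0 := by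
    refine isOpen_Ioo.ae_eq_zero_of_integral_contDiff_smul_eq_zero hi.locallyIntegrableOn ?_
    intro ψ hψ hc hs
    have e0 : ∀ {f : ℝ → ℂ}, ∫ x, ψ x • f x = ∫ x in Ioo 0 L, ψ x • f x := by
      intro f
      refine (setIntegral_eq_integral_of_forall_compl_eq_zero fun x hx => ?_).symm
      rw [image_eq_zero_of_notMem_tsupport fun h => hx (hs h), zero_smul]
    set m := ∫ x, ψ x with hm
    have hψi : Integrable ψ := hψ.continuous.integrable_of_hasCompactSupport hc
    have hηi : Integrable η := hη.continuous.integrable_of_hasCompactSupport hηc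
    have hmc : HasCompactSupport (fun x => m * η x) := hηc.mul_left
    have hts : tsupport (fun x => ψ x - m * η x) ⊆ Ioo 0 L := by
      refine (tsupport_sub ψ fun x => m * η x).trans (union_subset hs ?_)
      exact (tsupport_mul_subset_right (f := fun _ => m)).trans hηs
    -- Since η has integral one, subtracting m η leaves mean zero, so the difference is an
    -- admissible derivative and can be tested against w.
    obtain ⟨φ, h1, h2, h3, h4⟩ := exists_primitive_test (ψ := fun x => ψ x - m * η x)
      (hψ.sub (contDiff_const.mul hη)) (hc.sub hmc) hts
      (by rw [integral_sub hψi (hηi.const_mul m), integral_const_mul, hη1, ← hm]; ring)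
    have h5 := hw φ h1 h2 h3
    rw [h4] at h5
    have h6 : ∫ x in Ioo 0 L, φ x • (0 : L1 L) x = 0 := by
      have := integral_test_smul (L := L) φ 0 0
      simpa using this
    rw [h6, neg_zero] at h5
    have e1 : ∫ x in Ioo 0 L, (ψ x - m * η x) • w x = (∫ x in Ioo 0 L, ψ x • w x) - m • k := by
      have hηw : Integrable (fun x => m • η x • w x) (volume.restrict (Ioo 0 L)) :=
        (integrable_test_smul hη.continuous hηc w).smul m
      rw [← integral_smul, ← integral_sub (integrable_test_smul hψ.continuous hc w) hηw]
      refine integral_congr_ae (Eventually.of_forall fun x => ?_)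
      simp only [sub_smul, mul_smul]
    have e2 : ∫ x in Ioo 0 L, ψ x • k = m • k := by
      rw [← e0, integral_smul_const]
    rw [e0]
    simp only [smul_sub]
    rw [integral_sub (integrable_test_smul hψ.continuous hc w) ?_, e2, ← e1, h5]
    exact hψi.integrableOn.smul_const k
  have := (ae_restrict_iff' (μ := volume) measurableSet_Ioo).2 key
  filter_upwards [this] with x hx
  exact sub_eq_zero.1 hx

theorem integrable_primitive_L1 (hL : 0 < L) (a : ℂ) (v : L1 L) :
    Integrable (fun x => a + ∫ t in 0..x, v t) (volume.restrict (Ioo 0 L)) := by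
  have : IntegrableOn (fun x => a + ∫ t in 0..x, v t) (Icc 0 L) :=
    (continuousOn_const.add (continuousOn_primitive_L1 hL v)).integrableOn_Icc
  exact this.mono_set Ioo_subset_Icc_self

theorem hasValueAtZero_of_ae_eq_primitive (hL : 0 < L) {u v : L1 L} {a : ℂ}
    (h : u =ᵐ[volume.restrict (Ioo 0 L)] fun x => a + ∫ t in 0..x, v t) : HasValueAtZero u a :=
  ⟨_, continuousOn_const.add (continuousOn_primitive_L1 hL v), h, by simp⟩

/-- By du Bois-Reymond, u minus the primitive of v is a constant; comparing the two continuous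
representatives at 0 identifies it as a. -/
theorem ae_eq_primitive_of_isWeakDeriv (hL : 0 < L) {u v : L1 L} {a : ℂ} (h : IsWeakDeriv u v)
    (ha : HasValueAtZero u a) :
    u =ᵐ[volume.restrict (Ioo 0 L)] fun x => a + ∫ t in 0..x, v t := by
  set g : L1 L := (integrable_primitive_L1 hL 0 v).toL1 _
  have hg : g =ᵐ[volume.restrict (Ioo 0 L)] fun x => 0 + ∫ t in 0..x, v t :=
    Integrable.coeFn_toL1 _
  have hw : IsWeakDeriv (u + (-1 : ℂ) • g) 0 := by
    have := h.add ((isWeakDeriv_of_ae_eq_primitive hL hg).smul (-1))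
    rwa [neg_one_smul ℂ v, add_neg_cancel] at this
  obtain ⟨k, hk⟩ := ae_eq_const_of_isWeakDeriv_zero hL hw
  have hu : u =ᵐ[volume.restrict (Ioo 0 L)] fun x => k + ∫ t in 0..x, v t := by
    filter_upwards [hk, hg, Lp.coeFn_add u ((-1 : ℂ) • g), Lp.coeFn_smul (-1 : ℂ) g]
      with x h1 h2 h3 h4
    rw [h3, Pi.add_apply, h4, Pi.smul_apply, h2, zero_add] at h1
    rw [← h1]
    simp
  obtain ⟨f, hf, hfe, rfl⟩ := ha
  have he : f =ᵐ[volume.restrict (Icc 0 L)] fun x => k + ∫ t in 0..x, v t := by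
    rw [← restrict_Ioo_eq_restrict_Icc]
    exact hfe.symm.trans hu
  have := Measure.eqOn_Icc_of_ae_eq volume hL.ne he hf
    (continuousOn_const.add (continuousOn_primitive_L1 hL v)) (left_mem_Icc.2 hL.le)
  simp only [intervalIntegral.integral_same, add_zero] at this
  rwa [this]

end

section

variable {L : ℝ}

/-! ### The Volterra operator -/

theorem intervalIntegrable_L1_sub (v : L1 L) {s t : ℝ} (hs : s ∈ Icc 0 L)
    (ht : t ∈ Icc 0 L) : IntervalIntegrable v volume s t := by
  rcases eq_or_lt_of_le (hs.1.trans hs.2) with rfl | hL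
  · rw [Icc_self] at hs ht
    rw [hs, ht]
  · refine (intervalIntegrable_L1 hL v).mono_set ?_
    rw [uIcc_of_le hL.le]
    exact ordConnected_Icc.uIcc_subset hs ht

theorem norm_L1_eq (hL : 0 < L) (v : L1 L) : ‖v‖ = ∫ t in 0..L, ‖v t‖ := by
  rw [L1.norm_eq_integral_norm, integral_Ioo_eq_intervalIntegral hL]

theorem norm_integral_L1_le (hL : 0 < L) (v : L1 L) {s t : ℝ} (hs : 0 ≤ s) (hst : s ≤ t)
    (ht : t ≤ L) : ‖∫ x in s..t, v x‖ ≤ ‖v‖ := by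
  refine (intervalIntegral.norm_integral_le_integral_norm hst).trans ?_
  rw [norm_L1_eq hL]
  exact intervalIntegral.integral_mono_interval hs hst ht
    (Eventually.of_forall fun _ => norm_nonneg _) (intervalIntegrable_L1 hL v).norm

theorem intervalIntegral_congr_of_ae_Ioo {E : Type*} [NormedAddCommGroup E] [NormedSpace ℝ E]
    {f g : ℝ → E} (h : f =ᵐ[volume.restrict (Ioo 0 L)] g) {s t : ℝ} (hs : s ∈ Icc 0 L)
    (ht : t ∈ Icc 0 L) : ∫ x in s..t, f x = ∫ x in s..t, g x := by
  refine intervalIntegral.integral_congr_ae_restrict ?_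
  rw [restrict_Ioo_eq_restrict_Icc] at h
  exact ae_restrict_of_ae_restrict_of_subset
    (uIoc_subset_uIcc.trans (ordConnected_Icc.uIcc_subset hs ht)) h

theorem integral_L1_add {u v : L1 L} {s t : ℝ} (hs : s ∈ Icc 0 L) (ht : t ∈ Icc 0 L) :
    ∫ x in s..t, (u + v : L1 L) x = (∫ x in s..t, u x) + ∫ x in s..t, v x := by
  rw [← intervalIntegral.integral_add (intervalIntegrable_L1_sub u hs ht)
    (intervalIntegrable_L1_sub v hs ht)]
  exact intervalIntegral_congr_of_ae_Ioo (Lp.coeFn_add u v) hs ht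

theorem integral_L1_smul {c : ℂ} {v : L1 L} {s t : ℝ} (hs : s ∈ Icc 0 L) (ht : t ∈ Icc 0 L) :
    ∫ x in s..t, (c • v : L1 L) x = c * ∫ x in s..t, v x := by
  rw [← intervalIntegral.integral_const_mul]
  exact intervalIntegral_congr_of_ae_Ioo (Lp.coeFn_smul c v) hs ht

variable (L) in
/-- The functional `f ↦ ∫₀ˢ f(x) dx`. -/
def primitiveAt (s : ℝ) : L1 L →L[ℂ] ℂ :=
  LinearMap.mkContinuous
    -- Integrating over `Iic s` against the restricted measure gives a functional of norm at most
    -- one for every real s, with no condition on s.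
    { toFun := fun f => ∫ x in Iic s, f x ∂volume.restrict (Ioo 0 L)
      map_add' := fun f g => by
        rw [← integral_add (L1.integrable_coeFn f).integrableOn (L1.integrable_coeFn g).integrableOn]
        exact integral_congr_ae (ae_restrict_of_ae (Lp.coeFn_add f g))
      map_smul' := fun c f => by
        rw [RingHom.id_apply, ← integral_smul]
        exact integral_congr_ae (ae_restrict_of_ae (Lp.coeFn_smul c f)) } 1 fun f => by
    rw [one_mul, L1.norm_eq_integral_norm]
    exact (norm_integral_le_integral_norm _).trans
      (setIntegral_le_integral (L1.integrable_coeFn f).norm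
        (Eventually.of_forall fun _ => norm_nonneg _))

theorem primitiveAt_apply {s : ℝ} (hs : 0 ≤ s) (hsL : s < L) (f : L1 L) :
    primitiveAt L s f = ∫ x in 0..s, f x := by
  change ∫ x in Iic s, f x ∂volume.restrict (Ioo 0 L) = _
  rw [Measure.restrict_restrict measurableSet_Iic, intervalIntegral.integral_of_le hs]
  congr 2
  ext x
  constructor
  · rintro ⟨h1, h2⟩
    exact ⟨h2.1, h1⟩
  · rintro ⟨h1, h2⟩
    exact ⟨h2, h1, lt_of_le_of_lt h2 hsL⟩

/-- The Volterra operator `f ↦ (x ↦ ∫₀ˣ f(t) dt)` on `L¹(0, L)`. -/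
def volterra (hL : 0 < L) : L1 L →L[ℂ] L1 L :=
  LinearMap.mkContinuous
    { toFun := fun f => (integrable_primitive_L1 hL 0 f).toL1 _
      map_add' := fun f g => by
        refine Lp.ext ?_
        filter_upwards [(integrable_primitive_L1 hL 0 (f + g)).coeFn_toL1,
          (integrable_primitive_L1 hL 0 f).coeFn_toL1, (integrable_primitive_L1 hL 0 g).coeFn_toL1,
          Lp.coeFn_add ((integrable_primitive_L1 hL 0 f).toL1 _)
            ((integrable_primitive_L1 hL 0 g).toL1 _), ae_restrict_mem measurableSet_Ioo]
          with x h1 h2 h3 h4 hx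
        rw [h1, h4, Pi.add_apply, h2, h3,
          integral_L1_add (left_mem_Icc.2 hL.le) (Ioo_subset_Icc_self hx)]
        ring
      map_smul' := fun c f => by
        refine Lp.ext ?_
        filter_upwards [(integrable_primitive_L1 hL 0 (c • f)).coeFn_toL1,
          (integrable_primitive_L1 hL 0 f).coeFn_toL1,
          Lp.coeFn_smul c ((integrable_primitive_L1 hL 0 f).toL1 _),
          ae_restrict_mem measurableSet_Ioo] with x h1 h2 h3 hx
        rw [RingHom.id_apply, h1, h3, Pi.smul_apply, h2,
          integral_L1_smul (left_mem_Icc.2 hL.le) (Ioo_subset_Icc_self hx), smul_eq_mul]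
        ring } L fun f => by
    change ‖(integrable_primitive_L1 hL 0 f).toL1 _‖ ≤ _
    rw [L1.norm_eq_integral_norm]
    refine (integral_mono_ae (g := fun _ => ‖f‖) (L1.integrable_coeFn _).norm
      (integrable_const _) ?_).trans ?_
    · filter_upwards [(integrable_primitive_L1 hL 0 f).coeFn_toL1,
        ae_restrict_mem measurableSet_Ioo] with x h1 hx
      rw [h1, zero_add]
      exact norm_integral_L1_le hL f le_rfl hx.1.le hx.2.le
    · simp [hL.le]

theorem volterra_coeFn (hL : 0 < L) (f : L1 L) :
    volterra hL f =ᵐ[volume.restrict (Ioo 0 L)] fun x => ∫ t in 0..x, f t := by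
  refine ((integrable_primitive_L1 hL 0 f).coeFn_toL1).trans ?_
  simp

variable (L) in
/-- The finite rank approximation of the Volterra operator on a uniform grid of `n` cells. -/
def stepVolterra (n : ℕ) : L1 L →L[ℂ] L1 L :=
  ∑ j ∈ Finset.range n, (primitiveAt L (j * (L / n))).smulRight
    (indicatorConstLp 1 (measurableSet_Ioc (a := j * (L / n)) (b := (j + 1 : ℕ) * (L / n)))
      (measure_ne_top (volume.restrict (Ioo 0 L)) _) (1 : ℂ))

theorem isCompactOperator_smulRight {E F : Type*} [NormedAddCommGroup E] [NormedSpace ℂ E]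
    [NormedAddCommGroup F] [NormedSpace ℂ F] (f : E →L[ℂ] ℂ) (x : F) :
    IsCompactOperator (f.smulRight x) := by
  have h := (isCompactOperator_of_locallyCompactSpace_dom f).clm_comp
    ((ContinuousLinearMap.id ℂ ℂ).smulRight x)
  exact h

theorem isCompactOperator_stepVolterra (n : ℕ) : IsCompactOperator (stepVolterra L n) := by
  have : ∀ s : Finset ℕ, IsCompactOperator (∑ j ∈ s, (primitiveAt L (j * (L / n))).smulRight
    (indicatorConstLp 1 (measurableSet_Ioc (a := j * (L / n)) (b := (j + 1 : ℕ) * (L / n)))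
      (measure_ne_top (volume.restrict (Ioo 0 L)) _) (1 : ℂ)) : L1 L →L[ℂ] L1 L) := by
    intro s
    induction s using Finset.induction_on with
    | empty => simpa using isCompactOperator_zero
    | insert a s ha ih =>
      rw [Finset.sum_insert ha]
      exact (isCompactOperator_smulRight _ _).add ih
  exact this _

theorem stepVolterra_coeFn {n : ℕ} (f : L1 L) :
    stepVolterra L n f =ᵐ[volume.restrict (Ioo 0 L)] fun x => ∑ j ∈ Finset.range n,
      primitiveAt L (j * (L / n)) f *
        (Ioc (j * (L / n)) ((j + 1 : ℕ) * (L / n))).indicator (fun _ => (1 : ℂ)) x := by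
  rw [stepVolterra, _root_.sum_apply]
  refine (Lp.coeFn_fun_finsetSum _ _).trans ?_
  have : ∀ᵐ x ∂volume.restrict (Ioo 0 L), ∀ j : ℕ,
      ((primitiveAt L (j * (L / n))).smulRight
        (indicatorConstLp 1 (measurableSet_Ioc (a := j * (L / n)) (b := (j + 1 : ℕ) * (L / n)))
          (measure_ne_top (volume.restrict (Ioo 0 L)) _) (1 : ℂ)) f : L1 L) x =
      primitiveAt L (j * (L / n)) f *
        (Ioc (j * (L / n)) ((j + 1 : ℕ) * (L / n))).indicator (fun _ => (1 : ℂ)) x := by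
    refine ae_all_iff.2 fun j => ?_
    rw [ContinuousLinearMap.smulRight_apply]
    filter_upwards [Lp.coeFn_smul (primitiveAt L (j * (L / n)) f) (indicatorConstLp 1
      (measurableSet_Ioc (a := j * (L / n)) (b := (j + 1 : ℕ) * (L / n)))
      (measure_ne_top (volume.restrict (Ioo 0 L)) _) (1 : ℂ)),
      indicatorConstLp_coeFn (p := 1) (μ := volume.restrict (Ioo 0 L))
        (hs := measurableSet_Ioc (a := j * (L / n)) (b := (j + 1 : ℕ) * (L / n)))
        (hμs := measure_ne_top (volume.restrict (Ioo 0 L)) _) (c := (1 : ℂ))] with x h1 h2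
    rw [h1, Pi.smul_apply, h2, smul_eq_mul]
  filter_upwards [this] with x hx
  exact Finset.sum_congr rfl fun j _ => hx j

/-- On a cell the difference is the integral of f from the left node to x, bounded by the mass of
|f| on that cell. Integrating over the cell contributes the factor L / n, and the masses add up to
the norm of f. -/
theorem norm_volterra_sub_stepVolterra_le (hL : 0 < L) {n : ℕ} (hn : 0 < n) (f : L1 L) :
    ‖volterra hL f - stepVolterra L n f‖ ≤ L / n * ‖f‖ := by
  have hn' : (0 : ℝ) < n := by exact_mod_cast hn
  set h := L / n with hh
  have hpos : 0 < h := by positivity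
  have hnh : n * h = L := by rw [hh]; field_simp
  have hmem : ∀ j ≤ n, (j : ℝ) * h ∈ Icc 0 L := fun j hj =>
    ⟨by positivity, by rw [← hnh]; gcongr⟩
  have hle : ∀ j : ℕ, (j : ℝ) * h ≤ (j + 1 : ℕ) * h := fun j => by
    gcongr
    simp
  have hsub : ∀ {v : L1 L} {j : ℕ}, j < n →
      IntervalIntegrable v volume (j * h) ((j + 1 : ℕ) * h) := fun {v j} hj =>
    intervalIntegrable_L1_sub v (hmem j hj.le) (hmem (j + 1) hj)
  rw [norm_L1_eq hL, norm_L1_eq hL]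
  have s1 := intervalIntegral.sum_integral_adjacent_intervals (μ := volume)
    (f := fun x => ‖(volterra hL f - stepVolterra L n f : L1 L) x‖) (a := fun j : ℕ => (j : ℝ) * h)
    (n := n) fun k hk => (hsub hk).norm
  have s2 := intervalIntegral.sum_integral_adjacent_intervals (μ := volume)
    (f := fun x => ‖f x‖) (a := fun j : ℕ => (j : ℝ) * h)
    (n := n) fun k hk => (hsub hk).norm
  simp only [Nat.cast_zero, zero_mul, hnh] at s1 s2
  rw [← s1, ← s2, Finset.mul_sum]
  refine Finset.sum_le_sum fun j hj => ?_
  have hj : j < n := Finset.mem_range.1 hj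
  have hae : ∀ᵐ x, x ∈ Ioc ((j : ℝ) * h) ((j + 1 : ℕ) * h) →
      ‖(volterra hL f - stepVolterra L n f : L1 L) x‖ ≤ ∫ t in j * h..(j + 1 : ℕ) * h, ‖f t‖ := by
    -- The last half-open cell contains L, which the open interval does not.
    have hL' : ∀ᵐ x : ℝ, x ≠ L := by simp [ae_iff, measure_singleton]
    have := (ae_restrict_iff' (μ := volume) measurableSet_Ioo).1
      ((volterra_coeFn hL f).and ((stepVolterra_coeFn (n := n) f).and
        (Lp.coeFn_sub (volterra hL f) (stepVolterra L n f))))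
    filter_upwards [this, hL'] with x hx hxL hxj
    have hx0 : x ∈ Ioo 0 L := ⟨(hmem j hj.le).1.trans_lt hxj.1,
      lt_of_le_of_ne (hxj.2.trans (hmem (j + 1) hj).2) hxL⟩
    obtain ⟨h1, h2, h3⟩ := hx hx0
    have e : ∑ i ∈ Finset.range n, primitiveAt L (i * h) f *
        (Ioc (i * h) ((i + 1 : ℕ) * h)).indicator (fun _ => (1 : ℂ)) x =
        ∫ t in 0..j * h, f t := by
      rw [Finset.sum_eq_single j]
      · rw [indicator_of_mem hxj, mul_one, primitiveAt_apply (hmem j hj.le).1 (hxj.1.trans hx0.2)]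
      · intro i _ hij
        rw [indicator_of_notMem, mul_zero]
        intro hxi
        apply hij
        have a1 : (i : ℝ) < (j + 1 : ℕ) := by
          have := hxi.1.trans_le hxj.2
          exact lt_of_mul_lt_mul_right this hpos.le
        have a2 : (j : ℝ) < (i + 1 : ℕ) := by
          have := hxj.1.trans_le hxi.2
          exact lt_of_mul_lt_mul_right this hpos.le
        have a1' : i < j + 1 := by exact_mod_cast a1
        have a2' : j < i + 1 := by exact_mod_cast a2
        omega
      · intro hj'
        exact absurd (Finset.mem_range.2 hj) hj'
    rw [h3, Pi.sub_apply, h1, h2, e, intervalIntegral.integral_interval_sub_left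
      (intervalIntegrable_L1_sub f (left_mem_Icc.2 hL.le) (Ioo_subset_Icc_self hx0))
      (intervalIntegrable_L1_sub f (left_mem_Icc.2 hL.le) (hmem j hj.le))]
    refine (intervalIntegral.norm_integral_le_integral_norm hxj.1.le).trans ?_
    exact intervalIntegral.integral_mono_interval le_rfl hxj.1.le hxj.2
      (Eventually.of_forall fun _ => norm_nonneg _) (hsub hj).norm
  have := intervalIntegral.integral_mono_ae_restrict (hle j) (hsub hj).norm
    (intervalIntegrable_const (c := ∫ t in j * h..(j + 1 : ℕ) * h, ‖f t‖)) (by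
      rw [← restrict_Ioc_eq_restrict_Icc]
      exact (ae_restrict_iff' (μ := volume) measurableSet_Ioc).2 hae)
  refine this.trans (le_of_eq ?_)
  rw [intervalIntegral.integral_const, smul_eq_mul]
  push_cast
  ring

theorem isCompactOperator_volterra (hL : 0 < L) : IsCompactOperator (volterra hL) := by
  refine isCompactOperator_of_tendsto (l := atTop) (F := fun n : ℕ => stepVolterra L n) ?_
    (Eventually.of_forall fun n => isCompactOperator_stepVolterra n)
  rw [tendsto_iff_norm_sub_tendsto_zero]
  refine squeeze_zero' (Eventually.of_forall fun _ => norm_nonneg _) ?_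
    (tendsto_const_div_atTop_nhds_zero_nat L)
  filter_upwards [eventually_gt_atTop 0] with n hn
  rw [norm_sub_rev]
  exact ContinuousLinearMap.opNorm_le_bound _ (by positivity) fun f =>
    norm_volterra_sub_stepVolterra_le hL hn f

end

section

variable {L : ℝ}

/-! ### The scalar boundary value problem `u' + μ u + c u = f`, `u(0) = a` -/

/-- `u ∈ W^{1,1}(0, L)` with `μ u ∈ L¹(0, L)` solves `u' + μ u + c u = f`, `u(0) = a`. -/
def IsSol (μ : ℝ → ℝ) (c : ℂ) (u : L1 L) (a : ℂ) (f : L1 L) : Prop :=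
  ∃ (hW : u ∈ W11 L) (hM : u ∈ mulDomain L μ), HasValueAtZero u a ∧
    weakDeriv L ⟨u, hW⟩ + mulOp L μ ⟨u, hM⟩ + c • u = f

section IsSol

variable {μ : ℝ → ℝ} {c : ℂ} {u v f g : L1 L} {a b : ℂ}

theorem IsSol.add (hu : IsSol μ c u a f) (hv : IsSol μ c v b g) :
    IsSol μ c (u + v) (a + b) (f + g) := by
  obtain ⟨h1, h2, h3, h4⟩ := hu
  obtain ⟨k1, k2, k3, k4⟩ := hv
  have e1 : weakDeriv L ⟨u + v, add_mem h1 k1⟩ = weakDeriv L ⟨u, h1⟩ + weakDeriv L ⟨v, k1⟩ :=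
    (congrArg (weakDeriv L) (AddMemClass.mk_add_mk (W11 L) u v h1 k1).symm).trans
      (map_add (weakDeriv L) _ _)
  have e2 : mulOp L μ ⟨u + v, add_mem h2 k2⟩ = mulOp L μ ⟨u, h2⟩ + mulOp L μ ⟨v, k2⟩ :=
    (congrArg (mulOp L μ) (AddMemClass.mk_add_mk (mulDomain L μ) u v h2 k2).symm).trans
      (map_add (mulOp L μ) _ _)
  refine ⟨add_mem h1 k1, add_mem h2 k2, h3.add k3, ?_⟩
  rw [e1, e2, ← h4, ← k4, smul_add]
  generalize weakDeriv L ⟨u, h1⟩ = p1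
  generalize weakDeriv L ⟨v, k1⟩ = p2
  generalize mulOp L μ ⟨u, h2⟩ = q1
  generalize mulOp L μ ⟨v, k2⟩ = q2
  abel

theorem IsSol.smul (k : ℂ) (hu : IsSol μ c u a f) : IsSol μ c (k • u) (k * a) (k • f) := by
  obtain ⟨h1, h2, h3, rfl⟩ := hu
  refine ⟨Submodule.smul_mem _ k h1, Submodule.smul_mem _ k h2, h3.smul k, ?_⟩
  have e1 : weakDeriv L ⟨k • u, Submodule.smul_mem _ k h1⟩ = k • weakDeriv L ⟨u, h1⟩ :=
    map_smul (weakDeriv L) k ⟨u, h1⟩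
  have e2 : mulOp L μ ⟨k • u, Submodule.smul_mem _ k h2⟩ = k • mulOp L μ ⟨u, h2⟩ :=
    map_smul (mulOp L μ) k ⟨u, h2⟩
  rw [e1, e2, smul_add, smul_add, smul_comm c k]

/-- Together with `isSol_of_primitive` this trades the weak formulation for an integral equation,
free of test functions. -/
theorem IsSol.primitive (hL : 0 < L) (hu : IsSol μ c u a f) :
    ∃ hM : u ∈ mulDomain L μ, u =ᵐ[volume.restrict (Ioo 0 L)]
      fun x => a + ∫ t in 0..x, (f - mulOp L μ ⟨u, hM⟩ - c • u : L1 L) t := by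
  obtain ⟨h1, h2, h3, h4⟩ := hu
  refine ⟨h2, ?_⟩
  have : weakDeriv L ⟨u, h1⟩ = f - mulOp L μ ⟨u, h2⟩ - c • u := by
    rw [← h4]
    abel
  rw [← this]
  exact ae_eq_primitive_of_isWeakDeriv hL (weakDeriv_spec ⟨u, h1⟩) h3

theorem isSol_of_primitive (hL : 0 < L) (hM : u ∈ mulDomain L μ)
    (h : u =ᵐ[volume.restrict (Ioo 0 L)]
      fun x => a + ∫ t in 0..x, (f - mulOp L μ ⟨u, hM⟩ - c • u : L1 L) t) :
    IsSol μ c u a f := by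
  have hw := isWeakDeriv_of_ae_eq_primitive hL h
  refine ⟨⟨_, hw⟩, hM, hasValueAtZero_of_ae_eq_primitive hL h, ?_⟩
  rw [(weakDeriv_spec ⟨u, ⟨_, hw⟩⟩).unique hw]
  abel

theorem coeFn_residual (hM : u ∈ mulDomain L μ) :
    (f - mulOp L μ ⟨u, hM⟩ - c • u : L1 L) =ᵐ[volume.restrict (Ioo 0 L)]
      fun t => f t - μ t * u t - c * u t := by
  filter_upwards [Lp.coeFn_sub (f - mulOp L μ ⟨u, hM⟩) (c • u), Lp.coeFn_sub f (mulOp L μ ⟨u, hM⟩),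
    Lp.coeFn_smul c u, (mulDomain_integrable ⟨u, hM⟩).coeFn_toL1] with x h1 h2 h3 h4
  rw [h1, Pi.sub_apply, h2, Pi.sub_apply, h3, Pi.smul_apply, smul_eq_mul]
  congr 2

end IsSol

/-! ### The integrating factor -/

/-- `x ↦ exp (c x + k ∫₀ˣ μ)`. -/
def gexp (μ : ℝ → ℝ) (k c : ℂ) (x : ℝ) : ℂ :=
  Complex.exp (c * x + k * ((∫ t in 0..x, μ t : ℝ) : ℂ))

section gexp

variable {μ : ℝ → ℝ}

theorem IsRepairRate.intervalIntegrable (hμ : IsRepairRate L μ) {l : ℝ} (h0 : 0 ≤ l) (hl : l < L) :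
    IntervalIntegrable μ volume 0 l := by
  rcases eq_or_lt_of_le h0 with rfl | h0
  · exact IntervalIntegrable.refl
  · exact (intervalIntegrable_iff_integrableOn_Ioo_of_le h0.le).2 (hμ.integrableOn l h0 hl)

theorem gexp_zero (k c : ℂ) : gexp μ k c 0 = 1 := by simp [gexp]

/-- The second factor is the integrating factor of u' + μ u + c u, the first the fundamental
solution. -/
theorem gexp_mul_gexp_neg (c : ℂ) (x : ℝ) : gexp μ (-1) (-c) x * gexp μ 1 c x = 1 := by
  rw [gexp, gexp, ← Complex.exp_add]
  convert Complex.exp_zero using 2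
  ring

theorem norm_gexp (k : ℝ) (c : ℂ) (x : ℝ) :
    ‖gexp μ k c x‖ = Real.exp (c.re * x + k * ∫ t in 0..x, μ t) := by
  rw [gexp, Complex.norm_exp]
  simp

theorem gexp_ofReal (k c x : ℝ) :
    gexp μ k c x = (Real.exp (c * x + k * ∫ t in 0..x, μ t) : ℝ) := by
  rw [gexp]
  push_cast
  rfl

/-- The exponent is absolutely continuous, hence bounded, and the exponential is Lipschitz on balls.
The restriction l < L is needed because μ is not integrable up to L. -/
theorem absolutelyContinuousOnInterval_gexp (hμ : IsRepairRate L μ) (k c : ℂ) {l : ℝ} (h0 : 0 ≤ l)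
    (hl : l < L) : AbsolutelyContinuousOnInterval (gexp μ k c) 0 l := by
  have h1 := absolutelyContinuousOnInterval_ofReal
    ((hμ.intervalIntegrable h0 hl).absolutelyContinuousOnInterval_intervalIntegral left_mem_uIcc)
  have h2 : AbsolutelyContinuousOnInterval (fun x : ℝ => c * x) 0 l := by
    refine ContDiffOn.absolutelyContinuousOnInterval (ContDiff.contDiffOn ?_)
    exact contDiff_const.mul Complex.ofRealCLM.contDiff
  have h3 := h2.add (h1.const_smul k)
  obtain ⟨C, hC⟩ := h3.exists_bound
  obtain ⟨K, hK⟩ := (Complex.contDiff_exp (n := 1)).contDiffOn.exists_lipschitzOnWith (by simp)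
    (convex_closedBall (0 : ℂ) C) (isCompact_closedBall 0 C)
  refine absolutelyContinuousOnInterval_of_dist_le (K := K) h3 fun x hx y hy => ?_
  exact hK.dist_le_mul _ (by simpa using hC x hx) _ (by simpa using hC y hy)

theorem ae_hasDerivAt_gexp (hμ : IsRepairRate L μ) (k c : ℂ) {l : ℝ} (h0 : 0 ≤ l)
    (hl : l < L) :
    ∀ᵐ x, x ∈ uIcc 0 l → HasDerivAt (gexp μ k c) ((c + k * μ x) * gexp μ k c x) x := by
  filter_upwards [(hμ.intervalIntegrable h0 hl).ae_hasDerivAt_integral] with x hx hx'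
  have h1 := ((hx hx' 0 left_mem_uIcc).ofReal_comp).const_mul k
  have h2 : HasDerivAt (fun x : ℝ => c * (x : ℂ)) c x := by
    simpa using ((hasDerivAt_id x).ofReal_comp).const_mul c
  have h3 := (h2.add h1).cexp
  rw [mul_comm]
  exact h3

theorem intervalIntegrable_deriv_gexp (hμ : IsRepairRate L μ) (k c : ℂ) {l : ℝ} (h0 : 0 ≤ l)
    (hl : l < L) : IntervalIntegrable (fun x => (c + k * μ x) * gexp μ k c x) volume 0 l := by
  have h := hμ.intervalIntegrable h0 hl
  have h' : IntervalIntegrable (fun x => (μ x : ℂ)) volume 0 l := ⟨h.1.ofReal, h.2.ofReal⟩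
  exact (intervalIntegrable_const.add (h'.const_mul k)).mul_continuousOn
    (absolutelyContinuousOnInterval_gexp hμ k c h0 hl).continuousOn

theorem rate_primitive_mono (hμ : IsRepairRate L μ) {s x : ℝ} (hs : 0 ≤ s) (hsx : s ≤ x)
    (hx : x < L) : ∫ t in 0..s, μ t ≤ ∫ t in 0..x, μ t := by
  refine intervalIntegral.integral_mono_interval le_rfl hs hsx ?_
    (hμ.intervalIntegrable (hs.trans hsx) hx)
  refine (ae_restrict_iff' measurableSet_Ioc).2 (Eventually.of_forall fun t ht => ?_)
  exact hμ.nonneg t ⟨ht.1, ht.2.trans_lt hx⟩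

/-- The integral of μ over `[s, x]` enters with a negative sign and can be dropped, leaving exp(-Re
c (x - s)). The bound is therefore uniform up to L, where the integrating factor itself need not be
bounded. -/
theorem norm_gexp_mul_le (hμ : IsRepairRate L μ) (c : ℂ) {s x : ℝ} (hs : 0 ≤ s) (hsx : s ≤ x)
    (hx : x < L) : ‖gexp μ (-1) (-c) x‖ * ‖gexp μ 1 c s‖ ≤ Real.exp (‖c‖ * L) := by
  have e1 := norm_gexp (μ := μ) (-1) (-c) x
  have e2 := norm_gexp (μ := μ) 1 c s
  push_cast at e1 e2
  rw [e1, e2, ← Real.exp_add]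
  refine Real.exp_le_exp.2 ?_
  have h1 := rate_primitive_mono hμ hs hsx hx
  have h2 : -c.re * (x - s) ≤ ‖c‖ * L := by
    refine mul_le_mul ?_ (by linarith) (by linarith) (norm_nonneg c)
    exact (neg_le_abs _).trans (Complex.abs_re_le_norm c)
  simp only [Complex.neg_re]
  linarith

end gexp

/-! ### Uniqueness -/

/-- On every `[0, x]` with x < L the product of the continuous representative and the integrating
factor has derivative zero and starts at 0. -/
theorem IsSol.eq_zero {μ : ℝ → ℝ} (hL : 0 < L) (hμ : IsRepairRate L μ) {c : ℂ} {u : L1 L}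
    (hu : IsSol μ c u 0 0) : u = 0 := by
  obtain ⟨hM, h⟩ := hu.primitive hL
  set w : L1 L := 0 - mulOp L μ ⟨u, hM⟩ - c • u with hw
  have hwe : w =ᵐ[volume.restrict (Ioo 0 L)]
      fun t => -(c + μ t) * (0 + ∫ s in 0..t, w s) := by
    filter_upwards [coeFn_residual (f := 0) (c := c) hM, h,
      Lp.coeFn_zero ℂ 1 (volume.restrict (Ioo 0 L))] with x h1 h2 h3
    rw [← h2, hw, h1, h3, Pi.zero_apply]
    ring
  have hw_int := intervalIntegrable_L1 hL w
  refine Lp.ext ?_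
  filter_upwards [h, Lp.coeFn_zero ℂ 1 (volume.restrict (Ioo 0 L)),
    ae_restrict_mem measurableSet_Ioo] with x h1 h2 hx
  rw [h1, h2, Pi.zero_apply]
  have hsub : uIcc 0 x ⊆ uIcc 0 L := by
    rw [uIcc_of_le hx.1.le, uIcc_of_le hL.le]
    exact Icc_subset_Icc_right hx.2.le
  have hwx := hw_int.mono_set hsub
  have key := mul_eq_add_integral (u := fun x => 0 + ∫ t in 0..x, w t) (v := gexp μ 1 c)
    hx.1.le ((contDiff_const (n := 1)).contDiffOn.absolutelyContinuousOnInterval.add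
      (absolutelyContinuousOnInterval_primitive hwx))
    (absolutelyContinuousOnInterval_gexp hμ 1 c hx.1.le hx.2) hwx
    (intervalIntegrable_deriv_gexp hμ 1 c hx.1.le hx.2)
    (by
      filter_upwards [hwx.ae_hasDerivAt_integral] with x hx hx'
      exact (hx hx' 0 left_mem_uIcc).const_add 0)
    (ae_hasDerivAt_gexp hμ 1 c hx.1.le hx.2) (right_mem_Icc.2 hx.1.le)
  have hz : ∫ t in 0..x, (w t * gexp μ 1 c t +
      (0 + ∫ s in 0..t, w s) * ((c + 1 * μ t) * gexp μ 1 c t)) = ∫ t in 0..x, (0 : ℂ) := by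
    refine intervalIntegral_congr_of_ae_Ioo ?_ (left_mem_Icc.2 hL.le) (Ioo_subset_Icc_self hx)
    filter_upwards [hwe] with t ht
    rw [ht]
    ring
  rw [hz] at key
  simp only [intervalIntegral.integral_same, intervalIntegral.integral_zero, add_zero,
    zero_mul] at key
  exact (mul_eq_zero.1 key).resolve_right (Complex.exp_ne_zero _)

theorem IsSol.unique {μ : ℝ → ℝ} (hL : 0 < L) (hμ : IsRepairRate L μ) {c a : ℂ} {u v f : L1 L}
    (hu : IsSol μ c u a f) (hv : IsSol μ c v a f) : u = v := by
  have h := hu.add (hv.smul (-1))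
  rw [neg_one_mul, add_neg_cancel, neg_one_smul, neg_one_smul, add_neg_cancel] at h
  exact add_neg_eq_zero.1 (h.eq_zero hL hμ)

end

section

variable {L : ℝ}

/-! ### Existence -/

/-- A function whose primitives of the norm are bounded on `[0, L)` is integrable on `(0, L)`. -/
theorem integrableOn_Ioo_of_bounded (hL : 0 < L) {g : ℝ → ℂ} {C : ℝ}
    (hg : ∀ x, 0 ≤ x → x < L → IntervalIntegrable g volume 0 x)
    (hC : ∀ x, 0 ≤ x → x < L → ∫ t in 0..x, ‖g t‖ ≤ C) :
    IntegrableOn g (Ioo 0 L) ∧ ∫ t in Ioo 0 L, ‖g t‖ ≤ C := by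
  -- Points of `[0, L)` tending to L, at which the hypotheses can be used.
  set b : ℕ → ℝ := fun n => L - L * (1 / ((n : ℝ) + 1)) with hb
  have hb0 : ∀ n, 0 ≤ b n := fun n => by
    have : 1 / ((n : ℝ) + 1) ≤ 1 := by
      rw [div_le_one (by positivity)]
      linarith [n.cast_nonneg (α := ℝ)]
    have := mul_le_mul_of_nonneg_left this hL.le
    simp only [hb]
    linarith
  have hbL : ∀ n, b n < L := fun n => by
    have : 0 < L * (1 / ((n : ℝ) + 1)) := by positivity
    simp only [hb]
    linarith
  have hbt : Tendsto b atTop (𝓝 L) := by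
    have := (tendsto_one_div_add_atTop_nhds_zero_nat (𝕜 := ℝ)).const_mul L
    simpa [hb] using this.const_sub L
  have h1 : IntegrableOn g (Ioc 0 L) := by
    refine integrableOn_Ioc_of_intervalIntegral_norm_bounded_right (I := C)
      (fun n => (hg (b n) (hb0 n) (hbL n)).1) hbt (Eventually.of_forall fun n => ?_)
    rw [← intervalIntegral.integral_of_le (hb0 n)]
    exact hC _ (hb0 n) (hbL n)
  refine ⟨h1.mono_set Ioo_subset_Ioc_self, ?_⟩
  rw [integral_Ioo_eq_intervalIntegral hL]
  have h2 : IntegrableOn (fun t => ‖g t‖) (uIcc 0 L) := by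
    rw [uIcc_of_le hL.le, integrableOn_Icc_iff_integrableOn_Ioc]
    exact h1.norm
  have h3 := intervalIntegral.continuousOn_primitive_interval h2 L right_mem_uIcc
  have h4 : Tendsto b atTop (𝓝[uIcc 0 L] L) := by
    refine tendsto_nhdsWithin_iff.2 ⟨hbt, Eventually.of_forall fun n => ?_⟩
    rw [uIcc_of_le hL.le]
    exact ⟨hb0 n, (hbL n).le⟩
  exact le_of_tendsto (h3.tendsto.comp h4)
    (Eventually.of_forall fun n => hC _ (hb0 n) (hbL n))

/-- The solution of `u' + μ u + c u = f`, `u(0) = a`, by variation of constants. -/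
def solFun (μ : ℝ → ℝ) (c a : ℂ) (f : ℝ → ℂ) (x : ℝ) : ℂ :=
  gexp μ (-1) (-c) x * (a + ∫ t in 0..x, gexp μ 1 c t * f t)

section solFun

variable {μ : ℝ → ℝ}

theorem intervalIntegrable_gexp_mul (hμ : IsRepairRate L μ) (k c : ℂ) {f : ℝ → ℂ} {x : ℝ}
    (h0 : 0 ≤ x) (hx : x < L) (hf : IntervalIntegrable f volume 0 L) :
    IntervalIntegrable (fun t => gexp μ k c t * f t) volume 0 x := by
  refine (hf.mono_set ?_).continuousOn_mul
    (absolutelyContinuousOnInterval_gexp hμ k c h0 hx).continuousOn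
  rw [uIcc_of_le h0, uIcc_of_le (h0.trans hx.le)]
  exact Icc_subset_Icc_right hx.le

theorem absolutelyContinuousOnInterval_variation (hμ : IsRepairRate L μ) (c a : ℂ) {f : ℝ → ℂ}
    {x : ℝ} (h0 : 0 ≤ x) (hx : x < L) (hf : IntervalIntegrable f volume 0 L) :
    AbsolutelyContinuousOnInterval (fun x => a + ∫ t in 0..x, gexp μ 1 c t * f t) 0 x :=
  (contDiff_const (n := 1)).contDiffOn.absolutelyContinuousOnInterval.add
    (absolutelyContinuousOnInterval_primitive (intervalIntegrable_gexp_mul hμ 1 c h0 hx hf))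

theorem continuousOn_solFun_Icc (hμ : IsRepairRate L μ) (c a : ℂ) {f : ℝ → ℂ}
    {x : ℝ} (h0 : 0 ≤ x) (hx : x < L) (hf : IntervalIntegrable f volume 0 L) :
    ContinuousOn (solFun μ c a f) (uIcc 0 x) :=
  (absolutelyContinuousOnInterval_gexp hμ (-1) (-c) h0 hx).continuousOn.mul
    (absolutelyContinuousOnInterval_variation hμ c a h0 hx hf).continuousOn

theorem continuousOn_solFun (hμ : IsRepairRate L μ) (c a : ℂ) {f : ℝ → ℂ}
    (hf : IntervalIntegrable f volume 0 L) : ContinuousOn (solFun μ c a f) (Ioo 0 L) := by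
  intro x hx
  obtain ⟨l, hl, hlL⟩ := exists_between hx.2
  have := continuousOn_solFun_Icc hμ c a (hx.1.trans hl).le hlL hf
  rw [uIcc_of_le (hx.1.trans hl).le] at this
  exact (this.continuousAt (Icc_mem_nhds hx.1 hl)).continuousWithinAt

/-- Product rule for the two factors of `solFun`; in the forcing term the exponentials cancel. -/
theorem solFun_eq_integral (hμ : IsRepairRate L μ) (c a : ℂ) {f : ℝ → ℂ}
    {x : ℝ} (h0 : 0 ≤ x) (hx : x < L) (hf : IntervalIntegrable f volume 0 L) :
    solFun μ c a f x =
      a + ∫ t in 0..x, (f t - μ t * solFun μ c a f t - c * solFun μ c a f t) := by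
  have hG := intervalIntegrable_gexp_mul hμ 1 c h0 hx hf
  have key := mul_eq_add_integral (u := gexp μ (-1) (-c))
    (v := fun x => a + ∫ t in 0..x, gexp μ 1 c t * f t) h0
    (absolutelyContinuousOnInterval_gexp hμ (-1) (-c) h0 hx)
    (absolutelyContinuousOnInterval_variation hμ c a h0 hx hf)
    (intervalIntegrable_deriv_gexp hμ (-1) (-c) h0 hx) hG
    (ae_hasDerivAt_gexp hμ (-1) (-c) h0 hx)
    (by
      filter_upwards [hG.ae_hasDerivAt_integral] with x hx hx'
      exact (hx hx' 0 left_mem_uIcc).const_add a) (right_mem_Icc.2 h0)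
  rw [gexp_zero, intervalIntegral.integral_same, add_zero, one_mul] at key
  rw [solFun, key]
  congr 1
  refine intervalIntegral.integral_congr fun t _ => ?_
  simp only [solFun]
  linear_combination f t * gexp_mul_gexp_neg (μ := μ) c t

/-- Moving the outer exponential under the integral leaves the kernel bounded in `norm_gexp_mul_le`;
the bound does not depend on x. -/
theorem norm_solFun_le (hμ : IsRepairRate L μ) (c a : ℂ) {f : ℝ → ℂ}
    {x : ℝ} (h0 : 0 ≤ x) (hx : x < L) (hf : IntervalIntegrable f volume 0 L) :
    ‖solFun μ c a f x‖ ≤ Real.exp (‖c‖ * L) * (‖a‖ + ∫ t in 0..L, ‖f t‖) := by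
  have hK := fun {s : ℝ} (hs : 0 ≤ s) (hsx : s ≤ x) => norm_gexp_mul_le hμ c hs hsx hx
  set K := Real.exp (‖c‖ * L)
  rw [solFun, mul_add, ← intervalIntegral.integral_const_mul]
  refine (norm_add_le _ _).trans ?_
  rw [mul_add]
  refine add_le_add ?_ ?_
  · rw [norm_mul]
    refine mul_le_mul_of_nonneg_right ?_ (norm_nonneg a)
    have := hK le_rfl h0
    rwa [gexp_zero, norm_one, mul_one] at this
  · rw [← intervalIntegral.integral_const_mul]
    have hs : uIcc 0 x ⊆ uIcc 0 L := by
      rw [uIcc_of_le h0, uIcc_of_le (h0.trans hx.le)]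
      exact Icc_subset_Icc_right hx.le
    refine (intervalIntegral.norm_integral_le_of_norm_le (g := fun t => K * ‖f t‖) h0 ?_
      ((hf.mono_set hs).norm.const_mul K)).trans ?_
    · refine Eventually.of_forall fun t ht => ?_
      rw [norm_mul, norm_mul, ← mul_assoc]
      exact mul_le_mul_of_nonneg_right (hK ht.1.le ht.2) (norm_nonneg _)
    · exact intervalIntegral.integral_mono_interval le_rfl h0 hx.le
        (Eventually.of_forall fun t => mul_nonneg (Real.exp_nonneg _) (norm_nonneg _))
        (hf.norm.const_mul K)

/-- The solution is dominated by the solution with the data `|a|`, `|f|`, `Re c`. -/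
theorem exists_solFun_majorant (c a : ℂ) (f : ℝ → ℂ) :
    ∃ w : ℝ → ℝ, (∀ x, 0 ≤ x → 0 ≤ w x) ∧
      (∀ x, solFun μ (c.re : ℂ) (‖a‖ : ℂ) (fun t => (‖f t‖ : ℂ)) x = w x) ∧
      ∀ x, 0 ≤ x → ‖solFun μ c a f x‖ ≤ w x := by
  have hG : ∀ t, ‖gexp μ 1 c t‖ = Real.exp (c.re * t + 1 * ∫ s in 0..t, μ s) := fun t => by
    simpa using norm_gexp (μ := μ) 1 c t
  have hg : ∀ t, ‖gexp μ (-1) (-c) t‖ = Real.exp (-c.re * t + -1 * ∫ s in 0..t, μ s) := fun t => by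
    simpa using norm_gexp (μ := μ) (-1) (-c) t
  refine ⟨fun x => ‖gexp μ (-1) (-c) x‖ * (‖a‖ + ∫ t in 0..x, ‖gexp μ 1 c t‖ * ‖f t‖), ?_, ?_, ?_⟩
  · intro x h
    refine mul_nonneg (norm_nonneg _) (add_nonneg (norm_nonneg _) ?_)
    exact intervalIntegral.integral_nonneg h fun t _ => by positivity
  · intro x
    have e1 : ∀ t, gexp μ 1 (c.re : ℂ) t = (‖gexp μ 1 c t‖ : ℝ) := fun t => by
      have := gexp_ofReal (μ := μ) 1 c.re t
      rw [hG, ← this]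
      simp
    have e2 : ∀ t, gexp μ (-1) (-(c.re : ℂ)) t = (‖gexp μ (-1) (-c) t‖ : ℝ) := fun t => by
      have := gexp_ofReal (μ := μ) (-1) (-c.re) t
      rw [hg, ← this]
      simp
    rw [solFun, e2]
    simp only [e1]
    push_cast
    rw [← intervalIntegral.integral_ofReal]
    push_cast
    rfl
  · intro x h0
    rw [solFun, norm_mul]
    refine mul_le_mul_of_nonneg_left ((norm_add_le _ _).trans ?_) (norm_nonneg _)
    refine add_le_add le_rfl ((intervalIntegral.norm_integral_le_integral_norm h0).trans ?_)
    simp only [norm_mul, le_refl]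

/-- The point is integrability of μ u up to L. The majorant w satisfies w(x) + ∫ μ w = |a| + ∫ |f| -
Re c ∫ w on `[0, x]`. Dropping w(x) ≥ 0 and bounding the last integral uniformly controls ∫ μ w,
hence ∫ μ |u|, independently of x. -/
theorem exists_isSol (hL : 0 < L) (hμ : IsRepairRate L μ) (c : ℂ) :
    ∃ C : ℝ, 0 ≤ C ∧ ∀ (a : ℂ) (f : L1 L), ∃ u : L1 L, IsSol μ c u a f ∧
      ‖u‖ ≤ C * (‖a‖ + ‖f‖) ∧ ∫ x in Ioo 0 L, ‖(μ x : ℂ) * u x‖ ≤ C * (‖a‖ + ‖f‖) ∧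
      u =ᵐ[volume.restrict (Ioo 0 L)] solFun μ c a f := by
  set K := Real.exp (‖c‖ * L)
  set K' := Real.exp (‖(c.re : ℂ)‖ * L)
  -- The first entry is the sup bound on u times the length L; the second comes from the identity
  -- for the majorant.
  refine ⟨max (K * L) (1 + ‖(c.re : ℂ)‖ * (L * K')), le_max_of_le_left (by positivity),
    fun a f => ?_⟩
  have hf := intervalIntegrable_L1 hL f
  have hN : ∫ t in 0..L, ‖f t‖ = ‖f‖ := (norm_L1_eq hL f).symm
  have hcont := continuousOn_solFun hμ c a hf
  have hmeas : AEStronglyMeasurable (solFun μ c a f) (volume.restrict (Ioo 0 L)) :=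
    hcont.aestronglyMeasurable measurableSet_Ioo
  have hbd : ∀ᵐ x ∂volume.restrict (Ioo 0 L), ‖solFun μ c a f x‖ ≤ K * (‖a‖ + ‖f‖) := by
    filter_upwards [ae_restrict_mem measurableSet_Ioo] with x hx
    rw [← hN]
    exact norm_solFun_le hμ c a hx.1.le hx.2 hf
  have hint : Integrable (solFun μ c a f) (volume.restrict (Ioo 0 L)) :=
    Integrable.of_bound hmeas _ hbd
  have hμi : ∀ x, 0 ≤ x → x < L → ∀ (c a : ℂ) {g : ℝ → ℂ}, IntervalIntegrable g volume 0 L →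
      IntervalIntegrable (fun t => (μ t : ℂ) * solFun μ c a g t) volume 0 x := by
    intro x h0 hx c a g hg
    have h := hμ.intervalIntegrable h0 hx
    have h' : IntervalIntegrable (fun x => (μ x : ℂ)) volume 0 x := ⟨h.1.ofReal, h.2.ofReal⟩
    exact h'.mul_continuousOn (continuousOn_solFun_Icc hμ c a h0 hx hg)
  obtain ⟨w, hw0, hw1, hw2⟩ := exists_solFun_majorant (μ := μ) c a f
  have hfn : IntervalIntegrable (fun t => (‖f t‖ : ℂ)) volume 0 L :=
    ⟨hf.1.norm.ofReal, hf.2.norm.ofReal⟩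
  have hfn' : ∫ t in 0..L, ‖(‖f t‖ : ℂ)‖ = ‖f‖ := by simpa using hN
  have hmass : ∀ x, 0 ≤ x → x < L → ∫ t in 0..x, ‖(μ t : ℂ) * solFun μ c a f t‖ ≤
      (1 + ‖(c.re : ℂ)‖ * (L * K')) * (‖a‖ + ‖f‖) := by
    intro x h0 hx
    have hwμ := hμi x h0 hx (c.re : ℂ) (‖a‖ : ℂ) hfn
    have hwc := continuousOn_solFun_Icc hμ (c.re : ℂ) (‖a‖ : ℂ) h0 hx hfn
    have heq := solFun_eq_integral hμ (c.re : ℂ) (‖a‖ : ℂ) h0 hx hfn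
    have hwb : ∀ t ∈ uIoc 0 x, ‖solFun μ (c.re : ℂ) (‖a‖ : ℂ) (fun t => (‖f t‖ : ℂ)) t‖ ≤
        K' * (‖a‖ + ‖f‖) := by
      intro t ht
      rw [uIoc_of_le h0] at ht
      have := norm_solFun_le hμ (c.re : ℂ) (‖a‖ : ℂ) ht.1.le (ht.2.trans_lt hx) hfn
      rwa [hfn', Complex.norm_real ‖a‖, norm_norm] at this
    have hsub : uIcc 0 x ⊆ uIcc 0 L := by
      rw [uIcc_of_le h0, uIcc_of_le hL.le]
      exact Icc_subset_Icc_right hx.le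
    rw [intervalIntegral.integral_sub ((hfn.mono_set hsub).sub hwμ)
      (hwc.intervalIntegrable.const_mul _), intervalIntegral.integral_sub (hfn.mono_set hsub) hwμ,
      intervalIntegral.integral_const_mul] at heq
    have hwbi := intervalIntegral.norm_integral_le_of_norm_le_const hwb
    have hle : ∫ t in 0..x, ‖(μ t : ℂ) * solFun μ c a f t‖ ≤ ∫ t in 0..x, μ t * w t := by
      have hi : IntervalIntegrable (fun t => μ t * w t) volume 0 x := by
        have h := hwμ
        simp only [hw1] at h
        have h1 : IntervalIntegrable (fun t => ((μ t : ℂ) * (w t : ℂ)).re) volume 0 x :=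
          ⟨h.1.re, h.2.re⟩
        simpa using h1
      refine intervalIntegral.integral_mono_on_of_le_Ioo h0 (hμi x h0 hx c a hf).norm hi ?_
      intro t ht
      have hμt := hμ.nonneg t ⟨ht.1, ht.2.trans hx⟩
      rw [norm_mul, Complex.norm_real, Real.norm_of_nonneg hμt]
      exact mul_le_mul_of_nonneg_left (hw2 t ht.1.le) hμt
    refine hle.trans ?_
    have hnf : ∫ t in 0..x, ‖f t‖ ≤ ‖f‖ := by
      rw [← hN]
      exact intervalIntegral.integral_mono_interval le_rfl h0 hx.le
        (Eventually.of_forall fun t => norm_nonneg _) hf.norm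
    have e1 : ∫ t in 0..x, (‖f t‖ : ℂ) = ((∫ t in 0..x, ‖f t‖ : ℝ) : ℂ) :=
      intervalIntegral.integral_ofReal
    have e2 : ∫ t in 0..x, (μ t : ℂ) * solFun μ (c.re : ℂ) (‖a‖ : ℂ) (fun t => (‖f t‖ : ℂ)) t =
        ((∫ t in 0..x, μ t * w t : ℝ) : ℂ) := by
      rw [← intervalIntegral.integral_ofReal]
      simp only [hw1, Complex.ofReal_mul]
    have e3 : ∫ t in 0..x, solFun μ (c.re : ℂ) (‖a‖ : ℂ) (fun t => (‖f t‖ : ℂ)) t =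
        ((∫ t in 0..x, w t : ℝ) : ℂ) := by
      rw [← intervalIntegral.integral_ofReal]
      simp only [hw1]
    rw [e3, Complex.norm_real] at hwbi
    rw [e1, e2, e3, hw1] at heq
    have heq' : w x = ‖a‖ + ((∫ t in 0..x, ‖f t‖) - (∫ t in 0..x, μ t * w t) -
        c.re * ∫ t in 0..x, w t) := by exact_mod_cast heq
    have hwx : 0 ≤ w x := hw0 x h0
    have h5 : -(c.re * ∫ t in 0..x, w t) ≤ ‖(c.re : ℂ)‖ * (L * K') * (‖a‖ + ‖f‖) := by
      refine (neg_le_abs _).trans ?_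
      rw [abs_mul, Complex.norm_real, Real.norm_eq_abs, mul_assoc, mul_assoc]
      refine mul_le_mul_of_nonneg_left (hwbi.trans ?_) (abs_nonneg _)
      rw [mul_comm]
      refine mul_le_mul_of_nonneg_right ?_ (by positivity)
      rw [sub_zero, abs_of_nonneg h0]
      exact hx.le
    linarith
  obtain ⟨hμint, hμbd⟩ := integrableOn_Ioo_of_bounded hL
    (fun x h0 hx => hμi x h0 hx c a hf) hmass
  set u : L1 L := hint.toL1 _
  have hu : u =ᵐ[volume.restrict (Ioo 0 L)] solFun μ c a f := hint.coeFn_toL1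
  have hμu : (fun x => (μ x : ℂ) * u x) =ᵐ[volume.restrict (Ioo 0 L)]
      fun x => (μ x : ℂ) * solFun μ c a f x := by
    filter_upwards [hu] with x hx
    rw [hx]
  have hM : u ∈ mulDomain L μ := Integrable.congr hμint hμu.symm
  refine ⟨u, isSol_of_primitive hL hM ?_, ?_, ?_, hu⟩
  · filter_upwards [hu, ae_restrict_mem measurableSet_Ioo] with x hx hx'
    rw [hx, solFun_eq_integral hμ c a hx'.1.le hx'.2 hf]
    congr 1
    refine intervalIntegral_congr_of_ae_Ioo ?_ (left_mem_Icc.2 hL.le) (Ioo_subset_Icc_self hx')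
    filter_upwards [hu, coeFn_residual (f := f) (c := c) hM] with t h1 h2
    rw [h2, h1]
  · rw [L1.norm_eq_integral_norm]
    refine (integral_mono_ae (g := fun _ => K * (‖a‖ + ‖f‖)) (L1.integrable_coeFn _).norm
      (integrable_const _) ?_).trans ?_
    · filter_upwards [hu, hbd] with x h1 h2
      rwa [h1]
    · have : ∫ _ in Ioo 0 L, K * (‖a‖ + ‖f‖) = K * L * (‖a‖ + ‖f‖) := by
        simp [hL.le]
        ring
      rw [this]
      exact mul_le_mul_of_nonneg_right (le_max_left _ _) (by positivity)
  · have e : ∫ x in Ioo 0 L, ‖(μ x : ℂ) * u x‖ = ∫ x in Ioo 0 L, ‖(μ x : ℂ) * solFun μ c a f x‖ :=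
      integral_congr_ae (hμu.fun_comp norm)
    rw [e]
    exact hμbd.trans (mul_le_mul_of_nonneg_right (le_max_right _ _) (by positivity))

end solFun

end

section

variable {L : ℝ} {μ : ℝ → ℝ} {c a : ℂ} {u e f : L1 L}

/-! ### The value at the right end point and the mass balance -/

/-- If the limit at L were nonzero, |u| > δ > 0 near L, so μ ≤ |μ u| / δ would be integrable there,
contradicting ∫ μ = ∞. -/
theorem primitive_eq_zero_of_mem_mulDomain (hL : 0 < L) (hμ : IsRepairRate L μ) {v : L1 L}
    (hM : u ∈ mulDomain L μ)
    (h : u =ᵐ[volume.restrict (Ioo 0 L)] fun x => a + ∫ t in 0..x, v t) :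
    a + ∫ t in 0..L, v t = 0 := by
  by_contra hne
  set U : ℝ → ℂ := fun x => a + ∫ t in 0..x, v t with hU
  have hc : ContinuousOn U (Icc 0 L) := continuousOn_const.add (continuousOn_primitive_L1 hL v)
  set δ := ‖U L‖ / 2 with hδ
  have hδ0 : 0 < δ := half_pos (norm_pos_iff.2 hne)
  have h1 : ∀ᶠ x in 𝓝[<] L, δ < ‖U x‖ := by
    have : Tendsto (fun x => ‖U x‖) (𝓝[Icc 0 L] L) (𝓝 ‖U L‖) :=
      (hc L (right_mem_Icc.2 hL.le)).norm
    have h2 := this.eventually (lt_mem_nhds (half_lt_self (norm_pos_iff.2 hne)))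
    rw [nhdsWithin_Icc_eq_nhdsLE hL] at h2
    exact h2.filter_mono (nhdsWithin_mono _ Iio_subset_Iic_self)
  obtain ⟨l, ⟨hl0, hlL⟩, hl⟩ := (mem_nhdsLT_iff_exists_mem_Ico_Ioo_subset hL).1 h1
  obtain ⟨m, hlm, hmL⟩ := exists_between hlL
  have hm0 : 0 < m := hl0.trans_lt hlm
  have htop := hμ.lintegral_eq_top
  rw [← Ioc_union_Ioo_eq_Ioo hm0.le hmL] at htop
  have hlt : ∫⁻ x in Ioc 0 m ∪ Ioo m L, ENNReal.ofReal (μ x) < ⊤ := by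
    refine (lintegral_union_le _ _ _).trans_lt (ENNReal.add_lt_top.2 ⟨?_, ?_⟩)
    · rw [restrict_Ioc_eq_restrict_Icc, ← restrict_Ioo_eq_restrict_Icc]
      exact (hμ.integrableOn m hm0 hmL).lintegral_lt_top
    · have hi : IntegrableOn (fun x => δ⁻¹ * ‖(μ x : ℂ) * u x‖) (Ioo m L) :=
        (Integrable.norm hM).const_mul δ⁻¹ |>.mono_measure
          (Measure.restrict_mono (Ioo_subset_Ioo_left hm0.le) le_rfl)
      refine (lintegral_mono_ae ?_).trans_lt hi.lintegral_lt_top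
      have h' := ae_restrict_of_ae_restrict_of_subset (Ioo_subset_Ioo_left (b := L) hm0.le) h
      filter_upwards [h', ae_restrict_mem measurableSet_Ioo] with x hx hx'
      refine ENNReal.ofReal_le_ofReal ?_
      have hμx : 0 ≤ μ x := hμ.nonneg x ⟨hm0.trans hx'.1, hx'.2⟩
      have hux : δ < ‖U x‖ := hl ⟨hlm.trans hx'.1, hx'.2⟩
      rw [hx, norm_mul, Complex.norm_real, Real.norm_of_nonneg hμx, inv_mul_eq_div, le_div_iff₀ hδ0]
      exact mul_le_mul_of_nonneg_left hux.le hμx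
  exact hlt.ne htop

theorem integralOp_eq (hL : 0 < L) (v : L1 L) : integralOp L v = ∫ x in 0..L, v x :=
  integral_Ioo_eq_intervalIntegral hL _

/-- Mass balance: the equation integrated over `(0, L)`, with no boundary term at L. -/
theorem IsSol.integralOp_mulOp (hL : 0 < L) (hμ : IsRepairRate L μ) (hu : IsSol μ c u a f)
    (hM : u ∈ mulDomain L μ) :
    integralOp L (mulOp L μ ⟨u, hM⟩) = a - c * integralOp L u + integralOp L f := by
  obtain ⟨hM', h⟩ := hu.primitive hL
  have h0 := primitive_eq_zero_of_mem_mulDomain hL hμ hM h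
  rw [← integralOp_eq hL, map_sub, map_sub, map_smul, smul_eq_mul] at h0
  linear_combination -h0

/-! ### The solution operator -/

/-- Uniqueness makes the solution linear in f. It is the Volterra operator applied to f - μ T f - c
T f, which is bounded in terms of f, so compactness is inherited. -/
theorem exists_solOp (hL : 0 < L) (hμ : IsRepairRate L μ) (c : ℂ) :
    ∃ T : L1 L →L[ℂ] L1 L, (∀ f, IsSol μ c (T f) 0 f) ∧ IsCompactOperator T := by
  obtain ⟨C, hC0, hC⟩ := exists_isSol hL hμ c
  choose S h1 h2 h3 _ using fun f => hC 0 f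
  simp only [norm_zero, zero_add] at h2 h3
  let T : L1 L →L[ℂ] L1 L := LinearMap.mkContinuous
    { toFun := S
      map_add' := fun f g => by
        have := (h1 f).add (h1 g)
        rw [add_zero] at this
        exact (h1 (f + g)).unique hL hμ this
      map_smul' := fun k f => by
        have := (h1 f).smul k
        rw [mul_zero] at this
        exact (h1 (k • f)).unique hL hμ this } C h2
  refine ⟨T, h1, ?_⟩
  -- The radius adds the bounds of f, μ T f and c T f for f in the unit ball.
  obtain ⟨K, hK, hKs⟩ := IsCompactOperator.image_closedBall_subset_compact
    (f := (volterra hL : L1 L →ₗ[ℂ] L1 L)) (isCompactOperator_volterra hL) (1 + C + ‖c‖ * C)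
  refine ⟨K, hK, mem_of_superset (Metric.closedBall_mem_nhds 0 one_pos) fun f hf => ?_⟩
  have hf1 : ‖f‖ ≤ 1 := by simpa using hf
  obtain ⟨hM, hp⟩ := (h1 f).primitive hL
  refine hKs ⟨f - mulOp L μ ⟨S f, hM⟩ - c • S f, ?_, ?_⟩
  · have hn : ‖mulOp L μ ⟨S f, hM⟩‖ ≤ C * ‖f‖ := by
      refine le_trans (le_of_eq ?_) (h3 f)
      rw [L1.norm_eq_integral_norm]
      exact integral_congr_ae ((mulDomain_integrable ⟨S f, hM⟩).coeFn_toL1.fun_comp norm)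
    rw [mem_closedBall_zero_iff]
    refine (norm_sub_le _ _).trans (add_le_add ((norm_sub_le _ _).trans (add_le_add hf1 ?_)) ?_)
    · exact hn.trans (mul_le_of_le_one_right hC0 hf1)
    · rw [norm_smul]
      exact mul_le_mul_of_nonneg_left ((h2 f).trans (mul_le_of_le_one_right hC0 hf1)) (norm_nonneg c)
  · refine Lp.ext ((volterra_coeFn hL _).trans (EventuallyEq.trans ?_ hp.symm))
    simp

/-! ### The fundamental solution -/

theorem exists_fundamental (hL : 0 < L) (hμ : IsRepairRate L μ) (c : ℂ) :
    ∃ e : L1 L, IsSol μ c e 1 0 := by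
  obtain ⟨C, _, hC⟩ := exists_isSol hL hμ c
  obtain ⟨e, he, _⟩ := hC 1 0
  exact ⟨e, he⟩

theorem IsSol.coeFn_fundamental (hL : 0 < L) (hμ : IsRepairRate L μ) (he : IsSol μ c e 1 0) :
    e =ᵐ[volume.restrict (Ioo 0 L)] gexp μ (-1) (-c) := by
  obtain ⟨C, _, hC⟩ := exists_isSol hL hμ c
  obtain ⟨e', he', _, _, h⟩ := hC 1 0
  rw [he.unique hL hμ he']
  refine h.trans ?_
  filter_upwards [ae_restrict_mem measurableSet_Ioo] with x hx
  have : ∫ t in 0..x, gexp μ 1 c t * (0 : L1 L) t = ∫ t in 0..x, (0 : ℂ) := by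
    refine intervalIntegral_congr_of_ae_Ioo ?_ (left_mem_Icc.2 hL.le) (Ioo_subset_Icc_self hx)
    filter_upwards [Lp.coeFn_zero ℂ 1 (volume.restrict (Ioo 0 L))] with t ht
    rw [ht, Pi.zero_apply, mul_zero]
  rw [solFun, this, intervalIntegral.integral_zero, add_zero, mul_one]

/-- The modulus of exp(-c x - ∫ μ) depends on c only through Re c. -/
theorem IsSol.coeFn_fundamental_ofReal (hL : 0 < L) (hμ : IsRepairRate L μ) (he : IsSol μ c e 1 0)
    {e' : L1 L} (he' : IsSol μ (c.re : ℂ) e' 1 0) :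
    e' =ᵐ[volume.restrict (Ioo 0 L)] fun x => ((‖e x‖ : ℝ) : ℂ) := by
  filter_upwards [he.coeFn_fundamental hL hμ, he'.coeFn_fundamental hL hμ] with x h1 h2
  have k1 := norm_gexp (μ := μ) (-1) (-c) x
  have k2 := gexp_ofReal (μ := μ) (-1) (-c.re) x
  push_cast at k1 k2
  rw [h2, h1, k1, k2]
  simp

theorem IsSol.integralOp_fundamental_nonneg (hL : 0 < L) (hμ : IsRepairRate L μ) {r : ℝ}
    (he : IsSol μ (r : ℂ) e 1 0) : ∃ t : ℝ, 0 ≤ t ∧ integralOp L e = t := by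
  refine ⟨∫ x in Ioo 0 L, ‖e x‖, integral_nonneg fun _ => norm_nonneg _, ?_⟩
  rw [← integral_complex_ofReal]
  exact integral_congr_ae (he.coeFn_fundamental_ofReal hL hμ (by simpa using he))

/-- Since |e| is the fundamental solution for Re c, its mass balance reads ∫ μ |e| + Re c ∫ |e| = 1;
the triangle inequality does the rest. -/
theorem IsSol.norm_fundamental_le (hL : 0 < L) (hμ : IsRepairRate L μ) (he : IsSol μ c e 1 0)
    (hM : e ∈ mulDomain L μ) (hc : 0 ≤ c.re) :
    ‖integralOp L (mulOp L μ ⟨e, hM⟩)‖ + c.re * ‖integralOp L e‖ ≤ 1 := by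
  obtain ⟨e', he'⟩ := exists_fundamental hL hμ (c.re : ℂ)
  have h := he.coeFn_fundamental_ofReal hL hμ he'
  obtain ⟨hW', hM', _⟩ := id he'
  have key := he'.integralOp_mulOp hL hμ hM'
  have hμnn : ∀ᵐ x ∂volume.restrict (Ioo 0 L), 0 ≤ μ x := by
    filter_upwards [ae_restrict_mem measurableSet_Ioo] with x hx
    exact hμ.nonneg x hx
  have e1 : integralOp L (mulOp L μ ⟨e', hM'⟩) =
      ((∫ x in Ioo 0 L, ‖(μ x : ℂ) * e x‖ : ℝ) : ℂ) := by
    rw [← integral_complex_ofReal]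
    refine integral_congr_ae ?_
    filter_upwards [(mulDomain_integrable ⟨e', hM'⟩).coeFn_toL1, h, hμnn] with x h1 h2 h3
    refine h1.trans ?_
    rw [h2, norm_mul, Complex.norm_real, Real.norm_of_nonneg h3, Complex.ofReal_mul]
  have e2 : integralOp L e' = ((∫ x in Ioo 0 L, ‖e x‖ : ℝ) : ℂ) := by
    rw [← integral_complex_ofReal]
    exact integral_congr_ae h
  rw [e1, e2, map_zero, add_zero] at key
  have key' : ∫ x in Ioo 0 L, ‖(μ x : ℂ) * e x‖ = 1 - c.re * ∫ x in Ioo 0 L, ‖e x‖ := by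
    exact_mod_cast key
  have n1 : ‖integralOp L (mulOp L μ ⟨e, hM⟩)‖ ≤ ∫ x in Ioo 0 L, ‖(μ x : ℂ) * e x‖ := by
    refine (norm_integral_le_integral_norm _).trans (le_of_eq ?_)
    exact integral_congr_ae ((mulDomain_integrable ⟨e, hM⟩).coeFn_toL1.fun_comp norm)
  have n2 : ‖integralOp L e‖ ≤ ∫ x in Ioo 0 L, ‖e x‖ := norm_integral_le_integral_norm _
  have n3 := mul_le_mul_of_nonneg_left n2 hc
  linarith

end

section

variable {L lam₁ lam₂ : ℝ} {μ₁ μ₂ : ℝ → ℝ}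

/-! ### The resolvent equation -/

/-- The total mass `p₀ + ∫ p₁ + ∫ p₂`. -/
def State.total (p : State L) : ℂ := p.p0 + integralOp L p.p1 + integralOp L p.p2

theorem State.ext' {p q : State L} (h0 : p.p0 = q.p0) (h1 : p.p1 = q.p1) (h2 : p.p2 = q.p2) :
    p = q := by
  have : State.mk p.p0 p.p1 p.p2 = State.mk q.p0 q.p1 q.p2 := by rw [h0, h1, h2]
  exact this

theorem State.total_smul (k : ℂ) (p : State L) : (k • p).total = k * p.total := by
  change k * p.p0 + integralOp L (k • p.p1) + integralOp L (k • p.p2) =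
    k * (p.p0 + integralOp L p.p1 + integralOp L p.p2)
  rw [map_smul, map_smul, smul_eq_mul, smul_eq_mul]
  ring

theorem State.total_zero : (0 : State L).total = 0 := by
  simpa using State.total_smul (0 : ℂ) (0 : State L)

/-- The system of scalar problems equivalent to `r p - A p = y`. -/
structure IsSystemSol (lam₁ lam₂ : ℝ) (μ₁ μ₂ : ℝ → ℝ) (r : ℂ) (p y : State L) : Prop where
  sol1 : IsSol μ₁ (r + lam₂) p.p1 (lam₁ * p.p0) y.p1
  sol2 : IsSol μ₂ r p.p2 (lam₂ * p.p0 + lam₂ * integralOp L p.p1) y.p2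
  total : r * p.total = y.total

/-- Substituting both mass balances into the equation for p₀ cancels every term with λ₁ or λ₂; only
conservation of total mass remains. -/
theorem isSystemSol_of_resolvent_eq (hL : 0 < L) (hμ₁ : IsRepairRate L μ₁)
    (hμ₂ : IsRepairRate L μ₂) {r : ℂ} (p : (systemOp L lam₁ lam₂ μ₁ μ₂).domain) {y : State L}
    (h : r • (p : State L) - systemOp L lam₁ lam₂ μ₁ μ₂ p = y) :
    IsSystemSol lam₁ lam₂ μ₁ μ₂ r (p : State L) y := by
  obtain ⟨p, h1, h2, h3, h4, h5, h6⟩ := p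
  have e0 : r * p.p0 - (-(lam₁ + lam₂) * p.p0 + integralOp L (mulOp L μ₁ ⟨p.p1, h3⟩)
      + integralOp L (mulOp L μ₂ ⟨p.p2, h4⟩)) = y.p0 := congrArg State.p0 h
  have e1 : r • p.p1 - -(weakDeriv L ⟨p.p1, h1⟩ + mulOp L μ₁ ⟨p.p1, h3⟩ + (lam₂ : ℂ) • p.p1)
      = y.p1 := congrArg State.p1 h
  have e2 : r • p.p2 - -(weakDeriv L ⟨p.p2, h2⟩ + mulOp L μ₂ ⟨p.p2, h4⟩) = y.p2 :=
    congrArg State.p2 h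
  have s1 : IsSol μ₁ (r + lam₂) p.p1 (lam₁ * p.p0) y.p1 := by
    refine ⟨h1, h3, h5, ?_⟩
    rw [← e1, add_smul, sub_neg_eq_add, add_left_comm]
  have s2 : IsSol μ₂ r p.p2 (lam₂ * p.p0 + lam₂ * integralOp L p.p1) y.p2 := by
    refine ⟨h2, h4, h6, ?_⟩
    rw [← e2, sub_neg_eq_add, add_comm]
  refine ⟨s1, s2, ?_⟩
  have i1 := s1.integralOp_mulOp hL hμ₁ h3
  have i2 := s2.integralOp_mulOp hL hμ₂ h4
  change r * (p.p0 + integralOp L p.p1 + integralOp L p.p2) =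
    y.p0 + integralOp L y.p1 + integralOp L y.p2
  linear_combination e0 + i1 + i2

theorem IsSystemSol.exists_resolvent_eq (hL : 0 < L) (hμ₁ : IsRepairRate L μ₁)
    (hμ₂ : IsRepairRate L μ₂) {r : ℂ} {p y : State L}
    (h : IsSystemSol lam₁ lam₂ μ₁ μ₂ r p y) :
    ∃ q : (systemOp L lam₁ lam₂ μ₁ μ₂).domain, (q : State L) = p ∧
      r • (q : State L) - systemOp L lam₁ lam₂ μ₁ μ₂ q = y := by
  obtain ⟨s1, s2, ht⟩ := h
  obtain ⟨h1, h3, h5, e1⟩ := id s1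
  obtain ⟨h2, h4, h6, e2⟩ := id s2
  have i1 := s1.integralOp_mulOp hL hμ₁ h3
  have i2 := s2.integralOp_mulOp hL hμ₂ h4
  refine ⟨⟨p, h1, h2, h3, h4, h5, h6⟩, rfl, State.ext' ?_ ?_ ?_⟩
  · change r * p.p0 - (-(lam₁ + lam₂) * p.p0 + integralOp L (mulOp L μ₁ ⟨p.p1, h3⟩)
      + integralOp L (mulOp L μ₂ ⟨p.p2, h4⟩)) = y.p0
    have ht' : r * (p.p0 + integralOp L p.p1 + integralOp L p.p2) =
      y.p0 + integralOp L y.p1 + integralOp L y.p2 := ht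
    linear_combination ht' - i1 - i2
  · change r • p.p1 - -(weakDeriv L ⟨p.p1, h1⟩ + mulOp L μ₁ ⟨p.p1, h3⟩ + (lam₂ : ℂ) • p.p1) = y.p1
    rw [← e1, add_smul, sub_neg_eq_add, add_left_comm]
  · change r • p.p2 - -(weakDeriv L ⟨p.p2, h2⟩ + mulOp L μ₂ ⟨p.p2, h4⟩) = y.p2
    rw [← e2, sub_neg_eq_add, add_comm]

/-! ### Solution formulas -/

/-- Fundamental solutions of the two scalar problems at the spectral parameter `r`. -/
structure IsFundamental (lam₂ : ℝ) (μ₁ μ₂ : ℝ → ℝ) (r : ℂ) (e₁ e₂ : L1 L) : Prop where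
  sol1 : IsSol μ₁ (r + lam₂) e₁ 1 0
  sol2 : IsSol μ₂ r e₂ 1 0

/-- The characteristic function: the total mass of the normalized solution of the
homogeneous scalar problems. -/
def charFun (lam₁ lam₂ : ℝ) (e₁ e₂ : L1 L) : ℂ :=
  1 + integralOp L ((lam₁ : ℂ) • e₁) +
    integralOp L (((lam₂ : ℂ) + lam₂ * integralOp L ((lam₁ : ℂ) • e₁)) • e₂)

/-- The normalized solution of the homogeneous scalar problems. -/
def baseState (lam₁ lam₂ : ℝ) (e₁ e₂ : L1 L) : State L :=
  State.mk 1 ((lam₁ : ℂ) • e₁)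
    (((lam₂ : ℂ) + lam₂ * integralOp L ((lam₁ : ℂ) • e₁)) • e₂)

theorem charFun_eq (e₁ e₂ : L1 L) : charFun lam₁ lam₂ e₁ e₂ =
    1 + lam₁ * integralOp L e₁ + (lam₂ + lam₂ * (lam₁ * integralOp L e₁)) * integralOp L e₂ := by
  simp only [charFun, map_smul, smul_eq_mul]

theorem exists_isFundamental (hL : 0 < L) (hμ₁ : IsRepairRate L μ₁) (hμ₂ : IsRepairRate L μ₂)
    (lam₂ : ℝ) (r : ℂ) : ∃ e₁ e₂ : L1 L, IsFundamental lam₂ μ₁ μ₂ r e₁ e₂ := by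
  obtain ⟨e₁, h₁⟩ := exists_fundamental hL hμ₁ (r + lam₂)
  obtain ⟨e₂, h₂⟩ := exists_fundamental hL hμ₂ r
  exact ⟨e₁, e₂, h₁, h₂⟩

section Formulas

variable {r : ℂ} {e₁ e₂ : L1 L}

theorem IsSystemSol.p1_eq (hL : 0 < L) (hμ₁ : IsRepairRate L μ₁) {p y : State L}
    (h : IsSystemSol lam₁ lam₂ μ₁ μ₂ r p y) (he : IsFundamental lam₂ μ₁ μ₂ r e₁ e₂) {v : L1 L}
    (hv : IsSol μ₁ (r + lam₂) v 0 y.p1) : p.p1 = ((lam₁ : ℂ) * p.p0) • e₁ + v := by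
  have := (he.sol1.smul ((lam₁ : ℂ) * p.p0)).add hv
  rw [mul_one, add_zero, smul_zero, zero_add] at this
  exact h.sol1.unique hL hμ₁ this

theorem IsSystemSol.p2_eq (hL : 0 < L) (hμ₂ : IsRepairRate L μ₂) {p y : State L}
    (h : IsSystemSol lam₁ lam₂ μ₁ μ₂ r p y) (he : IsFundamental lam₂ μ₁ μ₂ r e₁ e₂) {v : L1 L}
    (hv : IsSol μ₂ r v 0 y.p2) :
    p.p2 = ((lam₂ : ℂ) * p.p0 + lam₂ * integralOp L p.p1) • e₂ + v := by
  have := (he.sol2.smul ((lam₂ : ℂ) * p.p0 + lam₂ * integralOp L p.p1)).add hv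
  rw [mul_one, add_zero, smul_zero, zero_add] at this
  exact h.sol2.unique hL hμ₂ this

theorem IsSystemSol.eq_smul_baseState (hL : 0 < L) (hμ₁ : IsRepairRate L μ₁)
    (hμ₂ : IsRepairRate L μ₂) {p : State L}
    (h : IsSystemSol lam₁ lam₂ μ₁ μ₂ r p 0) (he : IsFundamental lam₂ μ₁ μ₂ r e₁ e₂) :
    p = p.p0 • baseState lam₁ lam₂ e₁ e₂ := by
  have z1 : IsSol μ₁ (r + lam₂) (0 : L1 L) 0 0 := by simpa using he.sol1.smul 0
  have z2 : IsSol μ₂ r (0 : L1 L) 0 0 := by simpa using he.sol2.smul 0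
  have h1 : p.p1 = p.p0 • ((lam₁ : ℂ) • e₁) := by
    have := h.p1_eq hL hμ₁ he z1
    rw [add_zero, mul_comm, mul_smul] at this
    exact this
  refine State.ext' (mul_one _).symm h1 ?_
  have h2 := h.p2_eq hL hμ₂ he z2
  rw [add_zero, h1, map_smul, smul_eq_mul] at h2
  have : p.p2 = p.p0 • (((lam₂ : ℂ) + lam₂ * integralOp L ((lam₁ : ℂ) • e₁)) • e₂) := by
    rw [h2, smul_smul]
    congr 1
    ring
  exact this

theorem isSystemSol_baseState (he : IsFundamental lam₂ μ₁ μ₂ r e₁ e₂)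
    (h : r * charFun lam₁ lam₂ e₁ e₂ = 0) :
    IsSystemSol lam₁ lam₂ μ₁ μ₂ r (baseState lam₁ lam₂ e₁ e₂) 0 := by
  refine ⟨?_, ?_, ?_⟩
  · have := he.sol1.smul (lam₁ : ℂ)
    rw [smul_zero] at this
    exact this
  · have := he.sol2.smul ((lam₂ : ℂ) + lam₂ * integralOp L ((lam₁ : ℂ) • e₁))
    rw [smul_zero, mul_one] at this
    change IsSol μ₂ r _ ((lam₂ : ℂ) * 1 + lam₂ * integralOp L ((lam₁ : ℂ) • e₁)) 0
    rw [mul_one]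
    exact this
  · rw [State.total_zero]
    exact h

theorem total_baseState : (baseState lam₁ lam₂ e₁ e₂).total = charFun lam₁ lam₂ e₁ e₂ := rfl

/-- Real parameters, of either sign, give nonnegative fundamental solutions, so `charFun` is 1 plus
nonnegative terms. -/
theorem charFun_ne_zero_of_real (hL : 0 < L) (hlam₁ : 0 < lam₁) (hlam₂ : 0 < lam₂)
    (hμ₁ : IsRepairRate L μ₁) (hμ₂ : IsRepairRate L μ₂) {s : ℝ}
    (he : IsFundamental lam₂ μ₁ μ₂ (s : ℂ) e₁ e₂) : charFun lam₁ lam₂ e₁ e₂ ≠ 0 := by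
  have h1 : IsSol μ₁ ((s + lam₂ : ℝ) : ℂ) e₁ 1 0 := by
    push_cast
    exact he.sol1
  obtain ⟨t₁, ht₁, i₁⟩ := h1.integralOp_fundamental_nonneg hL hμ₁
  obtain ⟨t₂, ht₂, i₂⟩ := he.sol2.integralOp_fundamental_nonneg hL hμ₂
  rw [charFun_eq, i₁, i₂]
  have : 0 < 1 + lam₁ * t₁ + (lam₂ + lam₂ * (lam₁ * t₁)) * t₂ := by positivity
  exact_mod_cast this.ne'

theorem charFun_ne_zero_of_re_nonneg (hL : 0 < L) (hlam₁ : 0 < lam₁) (hlam₂ : 0 < lam₂)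
    (hμ₁ : IsRepairRate L μ₁) (hμ₂ : IsRepairRate L μ₂) (hr : 0 ≤ r.re) (hr0 : r ≠ 0)
    (he : IsFundamental lam₂ μ₁ μ₂ r e₁ e₂) : charFun lam₁ lam₂ e₁ e₂ ≠ 0 := by
  intro h0
  rw [charFun_eq] at h0
  obtain ⟨_, hM₁, _⟩ := id he.sol1
  obtain ⟨_, hM₂, _⟩ := id he.sol2
  have i1 := he.sol1.integralOp_mulOp hL hμ₁ hM₁
  have i2 := he.sol2.integralOp_mulOp hL hμ₂ hM₂
  have n1 := he.sol1.norm_fundamental_le hL hμ₁ hM₁ (by simpa using add_nonneg hr hlam₂.le)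
  have n2 := he.sol2.norm_fundamental_le hL hμ₂ hM₂ hr
  rw [map_zero, add_zero] at i1 i2
  set m₁ := integralOp L (mulOp L μ₁ ⟨e₁, hM₁⟩)
  set m₂ := integralOp L (mulOp L μ₂ ⟨e₂, hM₂⟩)
  set ε₁ := integralOp L e₁
  set ε₂ := integralOp L e₂
  -- Multiply D = 0 by r and eliminate r ε₁ and r ε₂ through the mass balances.
  have key : r + (lam₁ + lam₂ : ℝ) = lam₁ * m₁ + lam₂ * m₂ + lam₁ * (lam₂ * (ε₁ * m₂)) := by
    push_cast
    linear_combination r * h0 - lam₁ * i1 - (lam₂ + lam₁ * lam₂ * ε₁) * i2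
  have n1' : ‖m₁‖ + lam₂ * ‖ε₁‖ ≤ 1 := by
    rw [Complex.add_re, Complex.ofReal_re] at n1
    nlinarith [norm_nonneg ε₁, mul_nonneg hr (norm_nonneg ε₁)]
  have n2' : ‖m₂‖ ≤ 1 := by
    linarith [mul_nonneg hr (norm_nonneg ε₂)]
  have hle : ‖r + (lam₁ + lam₂ : ℝ)‖ ≤ lam₁ + lam₂ := by
    rw [key]
    refine (norm_add₃_le).trans ?_
    simp only [norm_mul, Complex.norm_real, Real.norm_of_nonneg hlam₁.le,
      Real.norm_of_nonneg hlam₂.le]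
    have a1 : ‖ε₁‖ * ‖m₂‖ ≤ ‖ε₁‖ := mul_le_of_le_one_right (norm_nonneg _) n2'
    have a2 : lam₂ * (‖ε₁‖ * ‖m₂‖) ≤ lam₂ * ‖ε₁‖ := mul_le_mul_of_nonneg_left a1 hlam₂.le
    have a3 : lam₁ * (‖m₁‖ + lam₂ * (‖ε₁‖ * ‖m₂‖)) ≤ lam₁ * 1 :=
      mul_le_mul_of_nonneg_left (by linarith) hlam₁.le
    have a4 : lam₂ * ‖m₂‖ ≤ lam₂ * 1 := mul_le_mul_of_nonneg_left n2' hlam₂.le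
    linarith
  have hsq : Complex.normSq (r + (lam₁ + lam₂ : ℝ)) ≤ (lam₁ + lam₂) ^ 2 := by
    rw [Complex.normSq_eq_norm_sq]
    exact pow_le_pow_left₀ (norm_nonneg _) hle 2
  rw [Complex.normSq_apply] at hsq
  simp only [Complex.add_re, Complex.ofReal_re, Complex.add_im, Complex.ofReal_im, add_zero] at hsq
  -- The disc of radius λ₁ + λ₂ about -(λ₁ + λ₂) touches the half-plane Re r ≥ 0 only at 0.
  have hre : r.re = 0 := by
    nlinarith [mul_self_nonneg r.re, mul_self_nonneg r.im, mul_nonneg hr hlam₁.le,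
      mul_nonneg hr hlam₂.le, mul_pos hlam₁ hlam₂]
  rw [hre] at hsq
  have him : r.im = 0 := by
    have : r.im * r.im ≤ 0 := by nlinarith
    exact mul_self_eq_zero.1 (le_antisymm this (mul_self_nonneg _))
  exact hr0 (Complex.ext hre him)

end Formulas

end

section

variable {L lam₁ lam₂ : ℝ} {μ₁ μ₂ : ℝ → ℝ}

/-! ### Maps into the state space -/

section StateMaps

variable {E : Type*} [NormedAddCommGroup E] [NormedSpace ℂ E]

/-- The operator `x ↦ (P₀ x, P₁ x, P₂ x)`. -/
def mkCLM (P₀ : E →L[ℂ] ℂ) (P₁ P₂ : E →L[ℂ] L1 L) : E →L[ℂ] State L :=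
  (WithLp.prodContinuousLinearEquiv 1 ℂ ℂ (WithLp 1 (L1 L × L1 L))).symm.toContinuousLinearMap ∘L
    P₀.prod ((WithLp.prodContinuousLinearEquiv 1 ℂ (L1 L) (L1 L)).symm.toContinuousLinearMap ∘L
      P₁.prod P₂)

theorem continuous_stateMk :
    Continuous fun q : ℂ × L1 L × L1 L => State.mk q.1 q.2.1 q.2.2 :=
  (mkCLM (ContinuousLinearMap.fst ℂ ℂ (L1 L × L1 L))
    (ContinuousLinearMap.fst ℂ (L1 L) (L1 L) ∘L ContinuousLinearMap.snd ℂ ℂ (L1 L × L1 L))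
    (ContinuousLinearMap.snd ℂ (L1 L) (L1 L) ∘L
      ContinuousLinearMap.snd ℂ ℂ (L1 L × L1 L))).continuous

theorem isCompactOperator_mkCLM {P₀ : E →L[ℂ] ℂ} {P₁ P₂ : E →L[ℂ] L1 L}
    (h₁ : IsCompactOperator P₁) (h₂ : IsCompactOperator P₂) :
    IsCompactOperator (mkCLM P₀ P₁ P₂) := by
  obtain ⟨K₀, hK₀, n₀⟩ := isCompactOperator_of_locallyCompactSpace_dom P₀
  obtain ⟨K₁, hK₁, n₁⟩ := h₁
  obtain ⟨K₂, hK₂, n₂⟩ := h₂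
  refine ⟨_, (hK₀.prod (hK₁.prod hK₂)).image continuous_stateMk, ?_⟩
  filter_upwards [n₀, n₁, n₂] with x k₀ k₁ k₂
  exact ⟨(P₀ x, P₁ x, P₂ x), ⟨k₀, k₁, k₂⟩, rfl⟩

variable (L)

/-- The projection to `p₀`. -/
def proj0 : State L →L[ℂ] ℂ := WithLp.fstL 1 ℂ ℂ (WithLp 1 (L1 L × L1 L))

/-- The projection to `p₁`. -/
def proj1 : State L →L[ℂ] L1 L :=
  WithLp.fstL 1 ℂ (L1 L) (L1 L) ∘L WithLp.sndL 1 ℂ ℂ (WithLp 1 (L1 L × L1 L))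

/-- The projection to `p₂`. -/
def proj2 : State L →L[ℂ] L1 L :=
  WithLp.sndL 1 ℂ (L1 L) (L1 L) ∘L WithLp.sndL 1 ℂ ℂ (WithLp 1 (L1 L × L1 L))

/-- `u ↦ ∫₀ᴸ u(x) dx` as a bounded functional. -/
def integralCLM : L1 L →L[ℂ] ℂ :=
  (integralOp L).mkContinuous 1 fun u => by
    rw [one_mul, L1.norm_eq_integral_norm]
    exact norm_integral_le_integral_norm _

end StateMaps

/-! ### The resolvent -/

theorem isResolventAt_of_charFun_ne_zero (hL : 0 < L) (hμ₁ : IsRepairRate L μ₁)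
    (hμ₂ : IsRepairRate L μ₂) {r : ℂ} {e₁ e₂ : L1 L} (hr : r ≠ 0)
    (he : IsFundamental lam₂ μ₁ μ₂ r e₁ e₂) (hD : charFun lam₁ lam₂ e₁ e₂ ≠ 0) :
    ∃ R, IsResolventAt (systemOp L lam₁ lam₂ μ₁ μ₂) r R := by
  obtain ⟨T₁, hT₁, -⟩ := exists_solOp hL hμ₁ (r + lam₂)
  obtain ⟨T₂, hT₂, -⟩ := exists_solOp hL hμ₂ r
  set D := charFun lam₁ lam₂ e₁ e₂ with hDdef
  let I := integralCLM L
  -- This solves r · total(p) = total(y) for p₀: D p₀ is total(y) / r minus the masses contributed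
  -- by T₁ y₁, directly and through the boundary value of p₂, and by T₂ y₂.
  let P₀ : State L →L[ℂ] ℂ := D⁻¹ • (r⁻¹ • (proj0 L + I ∘L proj1 L + I ∘L proj2 L) -
    I ∘L T₁ ∘L proj1 L - I ∘L T₂ ∘L proj2 L -
      ((lam₂ : ℂ) * integralOp L e₂) • I ∘L T₁ ∘L proj1 L)
  let P₁ : State L →L[ℂ] L1 L := ((lam₁ : ℂ) • P₀).smulRight e₁ + T₁ ∘L proj1 L
  let P₂ : State L →L[ℂ] L1 L :=
    ((lam₂ : ℂ) • P₀ + (lam₂ : ℂ) • I ∘L P₁).smulRight e₂ + T₂ ∘L proj2 L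
  have hP₀ : ∀ y, D * P₀ y = r⁻¹ * y.total - integralOp L (T₁ y.p1) - integralOp L (T₂ y.p2) -
      lam₂ * integralOp L e₂ * integralOp L (T₁ y.p1) := fun y => mul_inv_cancel_left₀ hD _
  have hP₁ : ∀ y, P₁ y = ((lam₁ : ℂ) * P₀ y) • e₁ + T₁ y.p1 := fun y => rfl
  have hP₂ : ∀ y, P₂ y = ((lam₂ : ℂ) * P₀ y + lam₂ * integralOp L (P₁ y)) • e₂ + T₂ y.p2 :=
    fun y => rfl
  have hsol : ∀ y, IsSystemSol lam₁ lam₂ μ₁ μ₂ r (mkCLM P₀ P₁ P₂ y) y := by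
    intro y
    refine ⟨?_, ?_, ?_⟩
    · change IsSol μ₁ (r + lam₂) (P₁ y) (lam₁ * P₀ y) y.p1
      have := (he.sol1.smul ((lam₁ : ℂ) * P₀ y)).add (hT₁ y.p1)
      rw [mul_one, add_zero, smul_zero, zero_add] at this
      rw [hP₁]
      exact this
    · change IsSol μ₂ r (P₂ y) (lam₂ * P₀ y + lam₂ * integralOp L (P₁ y)) y.p2
      have := (he.sol2.smul ((lam₂ : ℂ) * P₀ y + lam₂ * integralOp L (P₁ y))).add (hT₂ y.p2)
      rw [mul_one, add_zero, smul_zero, zero_add] at this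
      rw [hP₂]
      exact this
    · change r * (P₀ y + integralOp L (P₁ y) + integralOp L (P₂ y)) = y.total
      have h := hP₀ y
      rw [hDdef, charFun_eq] at h
      rw [hP₂, hP₁]
      simp only [map_add, map_smul, smul_eq_mul]
      have hrr : r * r⁻¹ = 1 := mul_inv_cancel₀ hr
      linear_combination r * h + y.total * hrr
  refine ⟨mkCLM P₀ P₁ P₂, fun y => (hsol y).exists_resolvent_eq hL hμ₁ hμ₂, fun x => ?_⟩
  have hx := isSystemSol_of_resolvent_eq hL hμ₁ hμ₂ (r := r) x rfl
  set y := r • (x : State L) - systemOp L lam₁ lam₂ μ₁ μ₂ x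
  have k1 := hx.p1_eq hL hμ₁ he (hT₁ y.p1)
  have k2 := hx.p2_eq hL hμ₂ he (hT₂ y.p2)
  have k0 : P₀ y = (x : State L).p0 := by
    apply mul_left_cancel₀ hD
    have ht : r * ((x : State L).p0 + integralOp L (x : State L).p1 +
      integralOp L (x : State L).p2) = y.total := hx.total
    have i1 := congrArg (integralOp L) k1
    have i2 := congrArg (integralOp L) k2
    simp only [map_add, map_smul, smul_eq_mul] at i1 i2
    rw [hP₀, ← ht, inv_mul_cancel_left₀ hr, hDdef, charFun_eq, i2, i1]
    ring
  have k1' : P₁ y = (x : State L).p1 := by rw [hP₁, k0, k1]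
  exact State.ext' k0 k1' (by
    change P₂ y = _
    rw [hP₂, k0, k1', k2])

/-- The solution formulas hold at every r, with p₀ read off from the given R. So the last two
components of R are a rank-one operator plus a compact one, and the first is a functional. -/
theorem isCompactOperator_resolvent (hL : 0 < L) (hμ₁ : IsRepairRate L μ₁)
    (hμ₂ : IsRepairRate L μ₂) {r : ℂ} {R : State L →L[ℂ] State L}
    (hR : IsResolventAt (systemOp L lam₁ lam₂ μ₁ μ₂) r R) : IsCompactOperator R := by
  obtain ⟨e₁, e₂, he⟩ := exists_isFundamental hL hμ₁ hμ₂ lam₂ r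
  obtain ⟨T₁, hT₁, hc₁⟩ := exists_solOp hL hμ₁ (r + lam₂)
  obtain ⟨T₂, hT₂, hc₂⟩ := exists_solOp hL hμ₂ r
  let P₁ : State L →L[ℂ] L1 L := ((lam₁ : ℂ) • proj0 L ∘L R).smulRight e₁ + T₁ ∘L proj1 L
  let P₂ : State L →L[ℂ] L1 L := ((lam₂ : ℂ) • proj0 L ∘L R +
    (lam₂ : ℂ) • integralCLM L ∘L proj1 L ∘L R).smulRight e₂ + T₂ ∘L proj2 L
  have h₁ : IsCompactOperator P₁ :=
    (isCompactOperator_smulRight _ e₁).add (hc₁.comp_clm (proj1 L))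
  have h₂ : IsCompactOperator P₂ :=
    (isCompactOperator_smulRight _ e₂).add (hc₂.comp_clm (proj2 L))
  have hRe : R = mkCLM (proj0 L ∘L R) P₁ P₂ := by
    ext1 y
    obtain ⟨x, hx, hy⟩ := hR.1 y
    have hs := isSystemSol_of_resolvent_eq hL hμ₁ hμ₂ x hy
    rw [hx] at hs
    exact State.ext' rfl (hs.p1_eq hL hμ₁ he (hT₁ y.p1)) (hs.p2_eq hL hμ₂ he (hT₂ y.p2))
  rw [hRe]
  exact isCompactOperator_mkCLM h₁ h₂

/-! ### Eigenvalues -/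

theorem isSystemSol_of_eigen (hL : 0 < L) (hμ₁ : IsRepairRate L μ₁) (hμ₂ : IsRepairRate L μ₂)
    {r : ℂ} {x : (systemOp L lam₁ lam₂ μ₁ μ₂).domain}
    (hx : systemOp L lam₁ lam₂ μ₁ μ₂ x = r • (x : State L)) :
    IsSystemSol lam₁ lam₂ μ₁ μ₂ r (x : State L) 0 :=
  isSystemSol_of_resolvent_eq hL hμ₁ hμ₂ x (by rw [hx, sub_self])

/-- An eigenvector is p₀ times the base state, so p₀ ≠ 0, and conservation of mass reads r p₀ D(r) =
0 with D(r) ≠ 0. -/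
theorem eq_zero_of_isEigenvalue_real (hL : 0 < L) (hlam₁ : 0 < lam₁) (hlam₂ : 0 < lam₂)
    (hμ₁ : IsRepairRate L μ₁) (hμ₂ : IsRepairRate L μ₂) {r : ℝ}
    (h : IsEigenvalue (systemOp L lam₁ lam₂ μ₁ μ₂) (r : ℂ)) : r = 0 := by
  obtain ⟨x, hx0, hx⟩ := h
  obtain ⟨e₁, e₂, he⟩ := exists_isFundamental hL hμ₁ hμ₂ lam₂ (r : ℂ)
  have hs := isSystemSol_of_eigen hL hμ₁ hμ₂ hx
  have hb := hs.eq_smul_baseState hL hμ₁ hμ₂ he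
  have ht := hs.total
  rw [hb, State.total_smul, total_baseState, State.total_zero] at ht
  have hp : (x : State L).p0 ≠ 0 := by
    intro h0
    rw [h0, zero_smul] at hb
    exact hx0 hb
  have hD := charFun_ne_zero_of_real (lam₁ := lam₁) hL hlam₁ hlam₂ hμ₁ hμ₂ he
  exact_mod_cast (mul_eq_zero.1 ht).resolve_right (mul_ne_zero hp hD)

theorem mem_genEigenspace_succ {X : Type*} [NormedAddCommGroup X] [NormedSpace ℂ X]
    {A : X →ₗ.[ℂ] X} {r : ℂ} {k : ℕ} {x : X} : x ∈ genEigenspace A r (k + 1) ↔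
      ∃ d : A.domain, A d - r • (d : X) ∈ genEigenspace A r k ∧ (d : X) = x :=
  Submodule.mem_map

theorem isSimpleEigenvalue_zero (hL : 0 < L) (hlam₁ : 0 < lam₁) (hlam₂ : 0 < lam₂)
    (hμ₁ : IsRepairRate L μ₁) (hμ₂ : IsRepairRate L μ₂) :
    IsSimpleEigenvalue (systemOp L lam₁ lam₂ μ₁ μ₂) 0 := by
  obtain ⟨e₁, e₂, he⟩ := exists_isFundamental hL hμ₁ hμ₂ lam₂ 0
  have hD : charFun lam₁ lam₂ e₁ e₂ ≠ 0 := charFun_ne_zero_of_real (s := 0) hL hlam₁ hlam₂ hμ₁ hμ₂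
    (by simpa using he)
  set b := baseState lam₁ lam₂ e₁ e₂ with hb
  have hb0 : b ≠ 0 := by
    intro h
    apply hD
    rw [← total_baseState, ← hb, h, State.total_zero]
  obtain ⟨q, hq, hq'⟩ := (isSystemSol_baseState (lam₁ := lam₁) he
    (zero_mul _)).exists_resolvent_eq hL hμ₁ hμ₂
  have hAq : systemOp L lam₁ lam₂ μ₁ μ₂ q = 0 := by
    rwa [zero_smul, zero_sub, neg_eq_zero] at hq'
  refine ⟨⟨q, by rwa [hq], by rw [hAq, zero_smul]⟩, ?_⟩
  have hspan : (⨆ k, genEigenspace (systemOp L lam₁ lam₂ μ₁ μ₂) 0 k : Submodule ℂ (State L)) =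
      Submodule.span ℂ {b} := by
    apply le_antisymm
    · refine iSup_le fun k => ?_
      induction k with
      | zero => exact bot_le
      | succ k ih =>
        intro x hx
        obtain ⟨d, hd, rfl⟩ := mem_genEigenspace_succ.1 hx
        rw [zero_smul, sub_zero] at hd
        obtain ⟨t, ht⟩ := Submodule.mem_span_singleton.1 (ih hd)
        have h1 := isSystemSol_of_resolvent_eq hL hμ₁ hμ₂ d
          (r := 0) (y := (-t) • b) (by rw [zero_smul, zero_sub, ← ht, neg_smul])
        -- At r = 0 conservation says that A d has total mass zero. As A d = t b and b has mass D ≠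
        -- 0, this forces t = 0, so d already lies in the kernel.
        have h2 := h1.total
        rw [zero_mul, State.total_smul, hb, total_baseState] at h2
        have ht0 : t = 0 := neg_eq_zero.1 ((mul_eq_zero.1 h2.symm).resolve_right hD)
        rw [ht0, neg_zero, zero_smul] at h1
        rw [h1.eq_smul_baseState hL hμ₁ hμ₂ he]
        exact Submodule.smul_mem _ _ (Submodule.mem_span_singleton_self b)
    · rw [Submodule.span_singleton_le_iff_mem]
      refine Submodule.mem_iSup_of_mem 1 (mem_genEigenspace_succ.2 ⟨q, ?_, hq⟩)
      rw [hAq, zero_smul, sub_zero]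
      exact zero_mem _
  rw [hspan]
  exact finrank_span_singleton hb0

end

end Repairable

end

theorem proposition2p1 (L lam₁ lam₂ : ℝ) (μ₁ μ₂ : ℝ → ℝ)
    (hL : 0 < L) (hlam₁ : 0 < lam₁) (hlam₂ : 0 < lam₂)
    (hμ₁ : Repairable.IsRepairRate L μ₁) (hμ₂ : Repairable.IsRepairRate L μ₂) :
    ({r : ℂ | 0 < r.re} ∪ {r : ℂ | ∃ a : ℝ, a ≠ 0 ∧ r = Complex.I * a} ⊆
        Repairable.resolventSet (Repairable.systemOp L lam₁ lam₂ μ₁ μ₂)) ∧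
      (∀ (r : ℂ) (R : Repairable.State L →L[ℂ] Repairable.State L),
        Repairable.IsResolventAt (Repairable.systemOp L lam₁ lam₂ μ₁ μ₂) r R →
          IsCompactOperator R) ∧
      (Repairable.IsSimpleEigenvalue (Repairable.systemOp L lam₁ lam₂ μ₁ μ₂) 0 ∧
        ∀ r : ℝ, Repairable.IsEigenvalue (Repairable.systemOp L lam₁ lam₂ μ₁ μ₂) (r : ℂ) →
          r = 0) := by
  refine ⟨fun r hr => ?_, fun r R hR => Repairable.isCompactOperator_resolvent hL hμ₁ hμ₂ hR,
    Repairable.isSimpleEigenvalue_zero hL hlam₁ hlam₂ hμ₁ hμ₂, fun r hr =>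
      Repairable.eq_zero_of_isEigenvalue_real hL hlam₁ hlam₂ hμ₁ hμ₂ hr⟩
  -- Both pieces of the set lie in the closed right half-plane without 0, which is all the argument
  -- uses.
  have hr' : 0 ≤ r.re ∧ r ≠ 0 := by
    rcases hr with hr | ⟨a, ha, rfl⟩
    · have hr : 0 < r.re := hr
      exact ⟨hr.le, fun h => by simp [h] at hr⟩
    · exact ⟨by simp, by simpa using ha⟩
  obtain ⟨e₁, e₂, he⟩ := Repairable.exists_isFundamental hL hμ₁ hμ₂ lam₂ r
  exact Repairable.isResolventAt_of_charFun_ne_zero hL hμ₁ hμ₂ hr'.2 he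
    (Repairable.charFun_ne_zero_of_re_nonneg hL hlam₁ hlam₂ hμ₁ hμ₂ hr'.1 hr'.2 he)
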